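/- **Setting.** Let $N>1$ be an integer, $p\ge 2$ and $s\in(0,1)$ real with $ps<N$, and let $\Omega\subset\mathbb{R}^N$ be a bounded domain (nonempty connected open set) with $C^{1,1}$ boundary. Put $\Omega^c=\mathbb{R}^N\setminus\Omega$ and $p_s^*=\frac{Np}{N-ps}$. All functions are real valued and Lebesgue measurable, and functions equal a.e. are identified. For open $U\subseteq\mathbb{R}^N$, $W^{s,p}(U)$ is the set of $u\in L^p(U)$ with $\iint_{U\times U}\frac{|u(x)-u(y)|^p}{|x-y|^{N+ps}}\,dx\,dy<\infty$. Let $W^{s,p}_0(\Omega)=\{u\in W^{s,p}(\mathbb{R}^N): u=0 \text{ a.e. in }\Omega^c\}$, and let $\widetilde W^{s,p}(\Omega)$ be the set of $u\in L^p_{\rm loc}(\mathbb{R}^N)$ such that $u\in W^{s,p}(U)$ for some open $U\supseteq\overline\Omega$ and $\int_{\mathbb{R}^N}\frac{|u(x)|^{p-1}}{(1+|x|)^{N+ps}}\,dx<\infty$. For $u\in\widetilde W^{s,p}(\Omega)$ and $v\in W^{s,p}_0(\Omega)$ put $$\langle(-\Delta)_p^s u,v\rangle=\iint_{\mathbb{R}^N\times\mathbb{R}^N}\frac{|u(x)-u(y)|^{p-2}(u(x)-u(y))(v(x)-v(y))}{|x-y|^{N+ps}}\,dx\,dy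 .$$ Let $f:\Omega\times\mathbb{R}\to\mathbb{R}$ satisfy the following hypothesis ${\bf H}_0$: $f$ is a Carathéodory function ($f(\cdot,t)$ is measurable for all $t$, and $f(x,\cdot)$ is continuous for a.e. $x\in\Omega$), and there are $c_0>0$ and $q\in(p,p_s^*)$ such that $|f(x,t)|\le c_0(1+|t|^{q-1})$ for a.e. $x\in\Omega$ and all $t\in\mathbb{R}$. Consider the problem $$(-\Delta)_p^s u=f(x,u)\ \text{ in }\Omega,\qquad u=0\ \text{ in }\Omega^c. \tag{P}$$ - A *supersolution* of (P) is a $u\in\widetilde W^{s,p}(\Omega)$ with $u\ge0$ a.e. in $\Omega^c$ and $\langle(-\Delta)_p^s u,v\rangle\ge\int_\Omega f(x,u)v\,dx$ for all $v\in W^{s,p}_0(\Omega)$ with $v\ge0$ a.e. A *subsolution* is defined with both inequalities for $u$ reversed. - A *solution* of (P) is a $u\in W^{s,p}_0(\Omega)$ with $\langle(-\Delta)_p^s u,v\rangle=\int_\Omega f(x,u)v\,dx$ for all $v\in W^{s,p}_0(\Omega)$. - A *sub-supersolution pair* $(\underline u,\overline u)$ consists of a subsolution $\underline u$ and a supersolution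 $\overline u$ with $\underline u\le\overline u$ a.e. in $\Omega$; then $\mathcal S(\underline u,\overline u)$ is the set of solutions $u$ of (P) with $\underline u\le u\le\overline u$ a.e. in $\Omega$. **Lemma 3.3.** Let ${\bf H}_0$ hold and let $(\underline u,\overline u)$ be a sub-supersolution pair of (P). Then $\mathcal S(\underline u,\overline u)$ is directed with respect to the a.e. pointwise order, that is, both downward and upward directed: for all $u_1,u_2\in\mathcal S(\underline u,\overline u)$ there are $u_3,u_4\in\mathcal S(\underline u,\overline u)$ with $u_3\le u_1$, $u_3\le u_2$, $u_1\le u_4$ and $u_2\le u_4$ a.e. -/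

import Mathlib

open MeasureTheory Set
open scoped ENNReal NNReal

noncomputable section

namespace FracPLaplace

/-- Euclidean space `ℝ^N`. -/
abbrev RN (N : ℕ) : Type := EuclideanSpace ℝ (Fin N)

/-- `Ω` has `C^{1,1}` boundary: near every boundary point, `Ω` is, in suitable orthonormal
coordinates, the strict epigraph of a `C^1` function with Lipschitz gradient. Here `e` is the unit
vector of the vertical axis, and the horizontal variable ranges over its orthogonal complement. -/
def HasC11Boundary {N : ℕ} (Ω : Set (RN N)) : Prop :=
  ∀ x₀ ∈ frontier Ω, ∃ e : RN N, ‖e‖ = 1 ∧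
    ∃ φ : (Submodule.span ℝ {e})ᗮ → ℝ,
      ContDiff ℝ 1 φ ∧ (∃ K : ℝ≥0, LipschitzWith K (fderiv ℝ φ)) ∧
      ∃ r : ℝ, 0 < r ∧ ∀ x ∈ Metric.ball x₀ r,
        (x ∈ Ω ↔ φ ((Submodule.span ℝ {e})ᗮ.orthogonalProjectionOnto x) < inner ℝ e x)

/-- A bounded domain (nonempty connected open set) with `C^{1,1}` boundary. -/
structure IsC11Domain {N : ℕ} (Ω : Set (RN N)) : Prop where
  isOpen : IsOpen Ω
  isConnected : IsConnected Ω
  isBounded : Bornology.IsBounded Ω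
  boundary : HasC11Boundary Ω

/-- The `p`-th power of the Gagliardo seminorm on `U`:
`∬_{U × U} |u(x) - u(y)|^p / |x - y|^{N + ps} dx dy`, with values in `[0, ∞]`. -/
def gagliardo {N : ℕ} (s p : ℝ) (U : Set (RN N)) (u : RN N → ℝ) : ℝ≥0∞ :=
  ∫⁻ z : RN N × RN N, ENNReal.ofReal (|u z.1 - u z.2| ^ p / ‖z.1 - z.2‖ ^ ((N : ℝ) + p * s))
    ∂((volume.restrict U).prod (volume.restrict U))

/-- `u ∈ W^{s,p}(U)`. -/
def MemW {N : ℕ} (s p : ℝ) (U : Set (RN N)) (u : RN N → ℝ) : Prop :=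
  MemLp u (ENNReal.ofReal p) (volume.restrict U) ∧ gagliardo s p U u < ∞

/-- `u ∈ W^{s,p}_0(Ω)`: `u ∈ W^{s,p}(ℝ^N)` and `u = 0` a.e. in `Ωᶜ`. -/
def MemW0 {N : ℕ} (s p : ℝ) (Ω : Set (RN N)) (u : RN N → ℝ) : Prop :=
  MemW s p univ u ∧ ∀ᵐ x ∂(volume.restrict Ωᶜ), u x = 0

/-- The space of all `u ∈ L^p_loc(ℝ^N)` with `u ∈ W^{s,p}(U)` for some open `U` containing the
closure of `Ω`, and `∫ |u(x)|^{p-1} / (1 + |x|)^{N + ps} dx < ∞`. -/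
def MemWTilde {N : ℕ} (s p : ℝ) (Ω : Set (RN N)) (u : RN N → ℝ) : Prop :=
  (∀ K : Set (RN N), IsCompact K → MemLp u (ENNReal.ofReal p) (volume.restrict K)) ∧
  (∃ U : Set (RN N), IsOpen U ∧ closure Ω ⊆ U ∧ MemW s p U u) ∧
  ∫⁻ x : RN N, ENNReal.ofReal (|u x| ^ (p - 1) / (1 + ‖x‖) ^ ((N : ℝ) + p * s)) < ∞

/-- The pairing `⟨(-Δ)_p^s u, v⟩ =
∬ |u(x) - u(y)|^{p-2} (u(x) - u(y)) (v(x) - v(y)) / |x - y|^{N + ps} dx dy` over `ℝ^N × ℝ^N`.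
The integrand is integrable for `u` in the space `MemWTilde` and `v` in `MemW0`. -/
def pairing {N : ℕ} (s p : ℝ) (u v : RN N → ℝ) : ℝ :=
  ∫ z : RN N × RN N,
    |u z.1 - u z.2| ^ (p - 2) * (u z.1 - u z.2) * (v z.1 - v z.2)
      / ‖z.1 - z.2‖ ^ ((N : ℝ) + p * s)

/-- `f : Ω × ℝ → ℝ` is a Carathéodory function: `f(·, t)` is (Lebesgue) measurable in `Ω` for all
`t`, and `f(x, ·)` is continuous for a.e. `x ∈ Ω`. Values of `f` outside `Ω` play no role. -/
def IsCaratheodory {N : ℕ} (Ω : Set (RN N)) (f : RN N → ℝ → ℝ) : Prop :=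
  (∀ t : ℝ, AEMeasurable (fun x => f x t) (volume.restrict Ω)) ∧
  ∀ᵐ x ∂(volume.restrict Ω), Continuous (f x)

/-- Carathéodory reaction with subcritical growth:
`|f(x,t)| ≤ c₀ (1 + |t|^{q-1})` with `c₀ > 0` and `p < q < p_s^* = N p / (N - p s)`. -/
def H0 {N : ℕ} (s p : ℝ) (Ω : Set (RN N)) (f : RN N → ℝ → ℝ) : Prop :=
  IsCaratheodory Ω f ∧
  ∃ c₀ q : ℝ, 0 < c₀ ∧ p < q ∧ q < (N : ℝ) * p / ((N : ℝ) - p * s) ∧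
    ∀ᵐ x ∂(volume.restrict Ω), ∀ t : ℝ, |f x t| ≤ c₀ * (1 + |t| ^ (q - 1))

/-- `u` is a supersolution of `(-Δ)_p^s u = f(x,u)` in `Ω`, `u = 0` in `Ωᶜ`. -/
def IsSupersolution {N : ℕ} (s p : ℝ) (Ω : Set (RN N)) (f : RN N → ℝ → ℝ)
    (u : RN N → ℝ) : Prop :=
  MemWTilde s p Ω u ∧ (∀ᵐ x ∂(volume.restrict Ωᶜ), 0 ≤ u x) ∧
  ∀ v : RN N → ℝ, MemW0 s p Ω v → (∀ᵐ x, 0 ≤ v x) →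
    ∫ x in Ω, f x (u x) * v x ≤ pairing s p u v

/-- `u` is a subsolution of `(-Δ)_p^s u = f(x,u)` in `Ω`, `u = 0` in `Ωᶜ`. -/
def IsSubsolution {N : ℕ} (s p : ℝ) (Ω : Set (RN N)) (f : RN N → ℝ → ℝ)
    (u : RN N → ℝ) : Prop :=
  MemWTilde s p Ω u ∧ (∀ᵐ x ∂(volume.restrict Ωᶜ), u x ≤ 0) ∧
  ∀ v : RN N → ℝ, MemW0 s p Ω v → (∀ᵐ x, 0 ≤ v x) →
    pairing s p u v ≤ ∫ x in Ω, f x (u x) * v x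

/-- `u` is a (weak) solution of `(-Δ)_p^s u = f(x,u)` in `Ω`, `u = 0` in `Ωᶜ`. -/
def IsSolution {N : ℕ} (s p : ℝ) (Ω : Set (RN N)) (f : RN N → ℝ → ℝ)
    (u : RN N → ℝ) : Prop :=
  MemW0 s p Ω u ∧
  ∀ v : RN N → ℝ, MemW0 s p Ω v → pairing s p u v = ∫ x in Ω, f x (u x) * v x

/-- `(u₁, u₂)` is a sub-supersolution pair: `u₁` is a subsolution, `u₂` a supersolution, and
`u₁ ≤ u₂` a.e. in `Ω`. -/
structure IsSubSuperPair {N : ℕ} (s p : ℝ) (Ω : Set (RN N)) (f : RN N → ℝ → ℝ)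
    (u₁ u₂ : RN N → ℝ) : Prop where
  sub : IsSubsolution s p Ω f u₁
  super : IsSupersolution s p Ω f u₂
  le : u₁ ≤ᵐ[volume.restrict Ω] u₂

/-- The set of the solutions `u` with `u₁ ≤ u ≤ u₂` a.e. in `Ω`. Its elements are representatives
of a.e.-classes; it is closed under a.e. equality. -/
def solutionSet {N : ℕ} (s p : ℝ) (Ω : Set (RN N)) (f : RN N → ℝ → ℝ)
    (u₁ u₂ : RN N → ℝ) : Set (RN N → ℝ) :=
  {u | IsSolution s p Ω f u ∧ u₁ ≤ᵐ[volume.restrict Ω] u ∧ u ≤ᵐ[volume.restrict Ω] u₂}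

/-- A set of functions is downward directed for the a.e. pointwise order. -/
def DownwardDirected {N : ℕ} (S : Set (RN N → ℝ)) : Prop :=
  ∀ u₁ ∈ S, ∀ u₂ ∈ S, ∃ u₃ ∈ S, u₃ ≤ᵐ[volume] u₁ ∧ u₃ ≤ᵐ[volume] u₂

/-- A set of functions is upward directed for the a.e. pointwise order. -/
def UpwardDirected {N : ℕ} (S : Set (RN N → ℝ)) : Prop :=
  ∀ u₁ ∈ S, ∀ u₂ ∈ S, ∃ u₃ ∈ S, u₁ ≤ᵐ[volume] u₃ ∧ u₂ ≤ᵐ[volume] u₃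

end FracPLaplace

end

/-!
# Directedness of the solution set between a subsolution and a supersolution

The problem is variational, so a solution below two given solutions `u₁, u₂` and above the
subsolution `a` can be found by minimization. Reflection `u ↦ -u`, `f(x, t) ↦ -f(x, -t)` turns
upward directedness into downward directedness, and only a subsolution is needed below.

Freeze the reaction below `a` and above each `uᵢ`, and let `g` be the smaller of the two frozen
reactions (`truncatedReaction`). Then `g = f` between `a` and `min u₁ u₂`, while
`g(x, t) ≤ f(x, uᵢ(x))` for `t ≥ uᵢ(x)` and `g(x, t) = f(x, a(x))` for `t ≤ a(x)`. Let
`J(u) = (1/p) [u]^p - ∫_Ω G(x, u)`, where `G` is the primitive of `g`. Convexity of `|t|^p` and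
monotonicity of `|t|^{p-2} t` give `[u]^p - [min u w]^p ≥ p ⟨(-Δ)_p^s w, u - min u w⟩`
(`energy_min_le`). With the equations for `u₁, u₂` and the inequality for `a` it follows that
truncating at `a`, `u₁` or `u₂` does not increase `J` (`functional_min_le`, `functional_max_le`).
In particular it is not needed that `min u₁ u₂` is a supersolution.

Hence a minimizer of `J` over the order interval `[a, min u₁ u₂]` in `W^{s,p}_0(Ω)` is a minimizer
over the whole space, so it satisfies the Euler-Lagrange equation with the reaction `g`
(`pairing_eq_of_minimizer`), which is `f` along the minimizer. A minimizer over the order interval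
exists (`exists_minimizer`): minimizing sequences are bounded in energy and dominated by a fixed
function, so a subsequence converges a.e. (`exists_subseq_tendsto_ae`); the energy is lower
semicontinuous by Fatou's lemma, and the integral of `G` converges by dominated convergence.

Two facts on fractional Sobolev spaces enter. Local integrability to every power below
`p* = Np/(N - ps)` (`MemW.integrableOn_rpow`) makes all integrals with `f` finite; it is proved by
iterating a pointwise estimate that improves the exponent `m` to `p + m ps/N`. Compactness comes
from the `L^1`-approximation of a function by its averages over small balls with centres in a
countable dense set (`setIntegral_abs_sub_average_le`).
-/

namespace FracPLaplace

variable {N : ℕ} {s p : ℝ} {U V Ω : Set (RN N)} {u v w : RN N → ℝ}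

/-! ### Elementary inequalities for powers -/

theorem add_rpow_le_two_rpow_mul {a b p : ℝ} (ha : 0 ≤ a) (hb : 0 ≤ b) (hp : 0 ≤ p) :
    (a + b) ^ p ≤ 2 ^ p * (a ^ p + b ^ p) := by
  have hm : 0 ≤ max a b := le_max_of_le_left ha
  calc (a + b) ^ p ≤ (2 * max a b) ^ p := by
        apply Real.rpow_le_rpow (by positivity) _ hp
        linarith [le_max_left a b, le_max_right a b]
    _ = 2 ^ p * (max a b) ^ p := Real.mul_rpow (by norm_num) hm
    _ ≤ 2 ^ p * (a ^ p + b ^ p) := by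
        gcongr
        rcases max_cases a b with h | h <;> rw [h.1] <;>
          linarith [Real.rpow_nonneg ha p, Real.rpow_nonneg hb p]

theorem rpow_sub_one_mul_le {a b p : ℝ} (ha : 0 ≤ a) (hb : 0 ≤ b) (hp : 1 ≤ p) :
    a ^ (p - 1) * b ≤ a ^ p + b ^ p := by
  have hm : 0 ≤ max a b := le_max_of_le_left ha
  calc a ^ (p - 1) * b ≤ (max a b) ^ (p - 1) * (max a b) := by
        exact mul_le_mul (Real.rpow_le_rpow ha (le_max_left _ _) (by linarith))
          (le_max_right _ _) hb (by positivity)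
    _ = (max a b) ^ p := by
        rcases hm.eq_or_lt with h | h
        · rw [← h]; simp [Real.zero_rpow (by linarith : p ≠ 0)]
        · rw [Real.rpow_sub_one h.ne']; field_simp
    _ ≤ a ^ p + b ^ p := by
        rcases max_cases a b with h | h <;> rw [h.1] <;>
          linarith [Real.rpow_nonneg ha p, Real.rpow_nonneg hb p]

theorem rpow_le_one_add_rpow {a r p : ℝ} (ha : 0 ≤ a) (hr : 0 ≤ r) (hrp : r ≤ p) :
    a ^ r ≤ 1 + a ^ p := by
  rcases le_total a 1 with h | h
  · linarith [Real.rpow_le_one ha h hr, Real.rpow_nonneg ha p]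
  · linarith [Real.rpow_le_rpow_of_exponent_le h hrp]

theorem abs_rpow_sub_two_mul_self {p : ℝ} (hp : 2 ≤ p) (b : ℝ) :
    |b| ^ (p - 2) * |b| = |b| ^ (p - 1) := by
  rcases eq_or_ne b 0 with rfl | h
  · simp [Real.zero_rpow (by linarith : p - 1 ≠ 0)]
  · have h' : 0 < |b| := abs_pos.2 h
    rw [show p - 1 = (p - 2) + 1 by ring, Real.rpow_add_one h'.ne']

/-- The tangent line inequality of the convex function `t ↦ |t| ^ p`. -/
theorem rpow_tangent_le {p : ℝ} (hp : 2 ≤ p) (a b : ℝ) :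
    p * (|b| ^ (p - 2) * b * (a - b)) ≤ |a| ^ p - |b| ^ p := by
  have hp0 : 0 < p := by linarith
  have h1 : |b| ^ (p - 1) * |a| ≤ (1 - 1 / p) * |b| ^ p + (1 / p) * |a| ^ p := by
    have := Real.geom_mean_le_arith_mean2_weighted (w₁ := 1 - 1 / p) (w₂ := 1 / p)
      (p₁ := |b| ^ p) (p₂ := |a| ^ p)
      (by rw [sub_nonneg, div_le_one hp0]; linarith) (by positivity) (by positivity)
      (by positivity) (by ring)
    rw [← Real.rpow_mul (abs_nonneg _), ← Real.rpow_mul (abs_nonneg _)] at this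
    have e1 : p * (1 - 1 / p) = p - 1 := by field_simp
    have e2 : p * (1 / p) = 1 := by field_simp
    rwa [e1, e2, Real.rpow_one] at this
  have h2 : |b| ^ (p - 2) * b * a ≤ |b| ^ (p - 1) * |a| := by
    rw [← abs_rpow_sub_two_mul_self hp]
    calc _ ≤ |(|b| ^ (p - 2) * b * a)| := le_abs_self _
      _ = _ := by rw [abs_mul, abs_mul, abs_of_nonneg (Real.rpow_nonneg (abs_nonneg b) _)]
  have h3 : |b| ^ (p - 2) * b * b = |b| ^ p := by
    rw [mul_assoc, ← abs_mul_abs_self, ← mul_assoc, abs_rpow_sub_two_mul_self hp]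
    rcases eq_or_ne b 0 with rfl | h
    · simp [Real.zero_rpow hp0.ne']
    · rw [Real.rpow_sub_one (abs_pos.2 h).ne', div_mul_cancel₀ _ (abs_pos.2 h).ne']
  have h4 := mul_le_mul_of_nonneg_left (h2.trans h1) hp0.le
  have e : p * ((1 - 1 / p) * |b| ^ p + (1 / p) * |a| ^ p) = (p - 1) * |b| ^ p + |a| ^ p := by
    field_simp
  rw [e] at h4
  rw [mul_sub, h3]
  linarith

theorem abs_rpow_sub_two_mul_mono {p : ℝ} (hp : 2 ≤ p) {a b : ℝ} (h : b ≤ a) :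
    |b| ^ (p - 2) * b ≤ |a| ^ (p - 2) * a := by
  rcases h.eq_or_lt with rfl | h
  · exact le_rfl
  have h1 := rpow_tangent_le hp a b
  have h2 := rpow_tangent_le hp b a
  have h3 : p * ((|b| ^ (p - 2) * b - |a| ^ (p - 2) * a) * (a - b)) ≤ 0 := by linarith
  have h4 : (|b| ^ (p - 2) * b - |a| ^ (p - 2) * a) * (a - b) ≤ 0 := by
    by_contra hc
    push Not at hc
    have : 0 < p := by linarith
    nlinarith [mul_pos this hc]
  by_contra hc
  push Not at hc
  nlinarith [mul_pos (sub_pos.2 hc) (sub_pos.2 h)]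

/-- The pointwise inequality behind truncation from above: with `m = min u w`, the energy density
of `u` exceeds that of `m` by at least the density of `p ⟨(-Δ)_p^s w, u - m⟩`. Here `u₁, u₂` and
`w₁, w₂` stand for the values at two points. -/
theorem min_energy_le {p : ℝ} (hp : 2 ≤ p) (u₁ u₂ w₁ w₂ : ℝ) :
    p * (|w₁ - w₂| ^ (p - 2) * (w₁ - w₂) * ((u₁ - min u₁ w₁) - (u₂ - min u₂ w₂))) ≤
      |u₁ - u₂| ^ p - |min u₁ w₁ - min u₂ w₂| ^ p := by
  set m₁ := min u₁ w₁ with hm₁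
  set m₂ := min u₂ w₂ with hm₂
  have h := rpow_tangent_le hp (u₁ - u₂) (m₁ - m₂)
  refine le_trans ?_ h
  apply mul_le_mul_of_nonneg_left _ (by linarith)
  have e : (u₁ - u₂) - (m₁ - m₂) = (u₁ - m₁) - (u₂ - m₂) := by ring
  rw [e]
  have k₁ : m₁ ≤ u₁ := min_le_left _ _
  have k₂ : m₂ ≤ u₂ := min_le_left _ _
  have l₁ : m₁ ≤ w₁ := min_le_right _ _
  have l₂ : m₂ ≤ w₂ := min_le_right _ _
  rcases lt_trichotomy (u₁ - m₁) (u₂ - m₂) with hd | hd | hd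
  · -- then `u₂ > w₂`, so `m₂ = w₂`
    have : m₂ = w₂ := by
      rcases min_choice u₂ w₂ with h' | h'
      · rw [hm₂, h', sub_self] at hd; linarith
      · exact h'
    exact mul_le_mul_of_nonpos_right
      (abs_rpow_sub_two_mul_mono hp (by linarith)) (by linarith)
  · simp [hd]
  · have : m₁ = w₁ := by
      rcases min_choice u₁ w₁ with h' | h'
      · rw [hm₁, h', sub_self] at hd; linarith
      · exact h'
    exact mul_le_mul_of_nonneg_right
      (abs_rpow_sub_two_mul_mono hp (by linarith)) (by linarith)

/-! ### The energy and the function spaces -/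

/-- The integrand of the Gagliardo seminorm, as a real number. On the diagonal, a null set, it is
a quotient by zero. -/
noncomputable def energyDensity (s p : ℝ) (u : RN N → ℝ) (z : RN N × RN N) : ℝ :=
  |u z.1 - u z.2| ^ p / ‖z.1 - z.2‖ ^ ((N : ℝ) + p * s)

/-- The integrand of `pairing`. -/
noncomputable def pairingDensity (s p : ℝ) (u v : RN N → ℝ) (z : RN N × RN N) : ℝ :=
  |u z.1 - u z.2| ^ (p - 2) * (u z.1 - u z.2) * (v z.1 - v z.2)
    / ‖z.1 - z.2‖ ^ ((N : ℝ) + p * s)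

/-- The `p`-th power of the Gagliardo seminorm on the whole space, as a real number. It is the
junk value `0` if the seminorm is infinite. -/
noncomputable def energy (s p : ℝ) (u : RN N → ℝ) : ℝ :=
  ∫ z : RN N × RN N, energyDensity s p u z

theorem energyDensity_nonneg (z : RN N × RN N) : 0 ≤ energyDensity s p u z := by
  unfold energyDensity; positivity

theorem measurable_kernel (r : ℝ) :
    Measurable fun z : RN N × RN N => ‖z.1 - z.2‖ ^ r := by
  fun_prop

theorem aestronglyMeasurable_energyDensity {μ : Measure (RN N)} [SFinite μ]
    (hu : AEStronglyMeasurable u μ) :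
    AEStronglyMeasurable (energyDensity s p u) (μ.prod μ) := by
  have h1 := hu.aemeasurable.comp_fst (ν := μ)
  have h2 := hu.aemeasurable.comp_snd (μ := μ)
  have h3 : AEMeasurable (fun z : RN N × RN N => |u z.1 - u z.2| ^ p) (μ.prod μ) :=
    ((measurable_id.abs.pow_const p).comp_aemeasurable (h1.sub h2))
  exact (h3.div (measurable_kernel _).aemeasurable).aestronglyMeasurable

theorem aestronglyMeasurable_pairingDensity {μ : Measure (RN N)} [SFinite μ]
    (hu : AEStronglyMeasurable u μ) (hv : AEStronglyMeasurable v μ) :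
    AEStronglyMeasurable (pairingDensity s p u v) (μ.prod μ) := by
  have h1 := hu.aemeasurable.comp_fst (ν := μ)
  have h2 := hu.aemeasurable.comp_snd (μ := μ)
  have h3 := hv.aemeasurable.comp_fst (ν := μ)
  have h4 := hv.aemeasurable.comp_snd (μ := μ)
  have h5 : AEMeasurable (fun z : RN N × RN N => |u z.1 - u z.2| ^ (p - 2)) (μ.prod μ) :=
    ((measurable_id.abs.pow_const (p - 2)).comp_aemeasurable (h1.sub h2))
  exact (((h5.mul (h1.sub h2)).mul (h3.sub h4)).div
    (measurable_kernel _).aemeasurable).aestronglyMeasurable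

theorem gagliardo_lt_top_iff (hu : AEStronglyMeasurable u (volume.restrict U)) :
    gagliardo s p U u < ∞ ↔
      Integrable (energyDensity s p u) ((volume.restrict U).prod (volume.restrict U)) := by
  unfold Integrable
  rw [hasFiniteIntegral_iff_ofReal (Filter.Eventually.of_forall energyDensity_nonneg)]
  exact ⟨fun h => ⟨aestronglyMeasurable_energyDensity hu, h⟩, fun h => h.2⟩

theorem MemW.integrable_energyDensity (hu : MemW s p U u) :
    Integrable (energyDensity s p u) ((volume.restrict U).prod (volume.restrict U)) :=
  (gagliardo_lt_top_iff hu.1.1).1 hu.2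

theorem MemW.integrable_rpow (hp : 0 < p) (hu : MemW s p U u) :
    Integrable (fun x => |u x| ^ p) (volume.restrict U) := by
  have := hu.1.integrable_norm_rpow (by simpa using hp) ENNReal.ofReal_ne_top
  simpa [ENNReal.toReal_ofReal hp.le] using this

theorem memW_univ_integrable_energyDensity (hu : MemW s p univ u) :
    Integrable (energyDensity s p u) := by
  have h := hu.integrable_energyDensity
  rw [Measure.restrict_univ] at h
  exact h

theorem MemW.mono (hu : MemW s p U u) (h : V ⊆ U) : MemW s p V u := by
  refine ⟨hu.1.mono_measure (Measure.restrict_mono h le_rfl), lt_of_le_of_lt ?_ hu.2⟩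
  apply lintegral_mono' _ le_rfl
  exact Measure.prod_mono (Measure.restrict_mono h le_rfl) (Measure.restrict_mono h le_rfl)

/-- A function that is controlled, together with its differences, by two functions of
`W^{s,p}(U)` belongs to `W^{s,p}(U)`. -/
theorem MemW.of_le (hp : 0 < p) (hu : MemW s p U u) (hv : MemW s p U v)
    (hw : AEStronglyMeasurable w (volume.restrict U)) (C : ℝ) (hC : 0 ≤ C)
    (h1 : ∀ x, |w x| ≤ C * (|u x| + |v x|))
    (h2 : ∀ x y, |w x - w y| ≤ C * (|u x - u y| + |v x - v y|)) : MemW s p U w := by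
  constructor
  · have := (hu.1.norm.add hv.1.norm)
    refine MemLp.of_le_mul (c := C) this hw (Filter.Eventually.of_forall fun x => ?_)
    simp only [Pi.add_apply, Real.norm_eq_abs]
    rw [abs_of_nonneg (a := |u x| + |v x|) (by positivity)]
    exact h1 x
  · rw [gagliardo_lt_top_iff hw]
    refine Integrable.mono' (g := fun z => (C ^ p * 2 ^ p) *
      (energyDensity s p u z + energyDensity s p v z))
      ((hu.integrable_energyDensity.add hv.integrable_energyDensity).const_mul _)
      (aestronglyMeasurable_energyDensity hw) (Filter.Eventually.of_forall fun z => ?_)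
    rw [Real.norm_of_nonneg (energyDensity_nonneg z)]
    unfold energyDensity
    rw [← add_div, ← mul_div_assoc]
    gcongr
    calc |w z.1 - w z.2| ^ p ≤ (C * (|u z.1 - u z.2| + |v z.1 - v z.2|)) ^ p :=
          Real.rpow_le_rpow (abs_nonneg _) (h2 _ _) hp.le
      _ = C ^ p * (|u z.1 - u z.2| + |v z.1 - v z.2|) ^ p :=
          Real.mul_rpow hC (by positivity)
      _ ≤ C ^ p * (2 ^ p * (|u z.1 - u z.2| ^ p + |v z.1 - v z.2| ^ p)) := by
          gcongr
          exact add_rpow_le_two_rpow_mul (abs_nonneg _) (abs_nonneg _) hp.le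
      _ = _ := by ring

theorem MemW.add (hp : 0 < p) (hu : MemW s p U u) (hv : MemW s p U v) :
    MemW s p U (fun x => u x + v x) := by
  refine hu.of_le hp hv (hu.1.1.add hv.1.1) 1 zero_le_one (fun x => ?_) fun x y => ?_
  · rw [one_mul]; exact abs_add_le _ _
  · rw [one_mul, add_sub_add_comm]; exact abs_add_le _ _

theorem MemW.const_mul (hp : 0 < p) (hu : MemW s p U u) (c : ℝ) :
    MemW s p U (fun x => c * u x) := by
  refine hu.of_le hp hu (hu.1.1.const_mul c) |c| (abs_nonneg c) (fun x => ?_) fun x y => ?_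
  · rw [abs_mul]; gcongr; linarith [abs_nonneg (u x)]
  · rw [← mul_sub, abs_mul]; gcongr; linarith [abs_nonneg (u x - u y)]

theorem abs_min_le_abs_add_abs (a b : ℝ) : |min a b| ≤ |a| + |b| := by
  rcases min_choice a b with h | h <;> rw [h] <;> linarith [abs_nonneg a, abs_nonneg b]

theorem abs_min_sub_min_le_abs_add_abs (a b c d : ℝ) :
    |min a b - min c d| ≤ |a - c| + |b - d| :=
  (abs_min_sub_min_le_max a b c d).trans
    (max_le (by linarith [abs_nonneg (b - d)]) (by linarith [abs_nonneg (a - c)]))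

theorem MemW.inf (hp : 0 < p) (hu : MemW s p U u) (hv : MemW s p U v) :
    MemW s p U (fun x => min (u x) (v x)) := by
  refine hu.of_le hp hv (hu.1.1.inf hv.1.1) 1 zero_le_one (fun x => ?_) fun x y => ?_
  · rw [one_mul]; exact abs_min_le_abs_add_abs _ _
  · rw [one_mul]; exact abs_min_sub_min_le_abs_add_abs _ _ _ _

theorem MemW0.add (hp : 0 < p) (hu : MemW0 s p Ω u) (hv : MemW0 s p Ω v) :
    MemW0 s p Ω (fun x => u x + v x) := by
  refine ⟨hu.1.add hp hv.1, ?_⟩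
  filter_upwards [hu.2, hv.2] with x h1 h2
  simp [h1, h2]

theorem MemW0.const_mul (hp : 0 < p) (hu : MemW0 s p Ω u) (c : ℝ) :
    MemW0 s p Ω (fun x => c * u x) := by
  refine ⟨hu.1.const_mul hp c, ?_⟩
  filter_upwards [hu.2] with x h1
  simp [h1]

theorem MemW0.neg (hp : 0 < p) (hu : MemW0 s p Ω u) : MemW0 s p Ω (fun x => -u x) := by
  simpa using hu.const_mul hp (-1)

theorem MemW0.sub (hp : 0 < p) (hu : MemW0 s p Ω u) (hv : MemW0 s p Ω v) :
    MemW0 s p Ω (fun x => u x - v x) := by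
  simpa only [sub_eq_add_neg] using hu.add hp (hv.neg hp)

theorem MemW0.aestronglyMeasurable (hu : MemW0 s p Ω u) : AEStronglyMeasurable u := by
  simpa using hu.1.1.1

theorem MemW0.ae_eq_zero (hΩ : IsOpen Ω) (hu : MemW0 s p Ω u) : ∀ᵐ x, x ∉ Ω → u x = 0 := by
  have := hu.2
  rwa [ae_restrict_iff' hΩ.measurableSet.compl] at this

theorem ae_prod_of_ae {P : RN N → Prop} (h : ∀ᵐ x, P x) :
    ∀ᵐ z : RN N × RN N, P z.1 ∧ P z.2 := by
  have h1 := Measure.quasiMeasurePreserving_fst (μ := (volume : Measure (RN N)))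
    (ν := (volume : Measure (RN N))) |>.ae h
  have h2 := Measure.quasiMeasurePreserving_snd (μ := (volume : Measure (RN N)))
    (ν := (volume : Measure (RN N))) |>.ae h
  exact h1.and h2

theorem MemWTilde.aestronglyMeasurable (hu : MemWTilde s p Ω u) : AEStronglyMeasurable u := by
  have h : ∀ n : ℕ, AEStronglyMeasurable u (volume.restrict (Metric.closedBall (0 : RN N) n)) :=
    fun n => (hu.1 _ (isCompact_closedBall _ _)).1
  have := aestronglyMeasurable_iUnion_iff.2 h
  rwa [Metric.iUnion_closedBall_nat, Measure.restrict_univ] at this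

/-! ### Interaction with the exterior of a neighbourhood of `Ω` -/

/-- The weight `(1 + |x|) ^ -(N + ps)` of the tail condition. -/
noncomputable def tailWeight (s p : ℝ) (x : RN N) : ℝ := ((1 + ‖x‖) ^ ((N : ℝ) + p * s))⁻¹

theorem tailWeight_nonneg (x : RN N) : 0 ≤ tailWeight s p x := by
  unfold tailWeight; positivity

theorem integrable_tailWeight (hps : 0 < p * s) :
    Integrable (tailWeight s p : RN N → ℝ) := by
  have := integrable_one_add_norm (E := RN N) (μ := volume) (r := (N : ℝ) + p * s)
    (by simp; exact hps)
  refine this.congr (Filter.Eventually.of_forall fun x => ?_)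
  simp only [tailWeight]
  rw [Real.rpow_neg (by positivity)]

theorem MemWTilde.integrable_tail (hu : MemWTilde s p Ω u) :
    Integrable fun x => |u x| ^ (p - 1) * tailWeight s p x := by
  have hm := hu.aestronglyMeasurable
  constructor
  · have h1 : AEMeasurable (fun x => |u x| ^ (p - 1)) :=
      (measurable_id.abs.pow_const (p - 1)).comp_aemeasurable hm.aemeasurable
    have h2 : Measurable (tailWeight s p : RN N → ℝ) := by unfold tailWeight; fun_prop
    exact (h1.mul h2.aemeasurable).aestronglyMeasurable
  · rw [hasFiniteIntegral_iff_ofReal (Filter.Eventually.of_forall fun x =>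
      mul_nonneg (by positivity) (tailWeight_nonneg x))]
    exact hu.2.2

/-- The kernel is dominated by the tail weight between `Ω` and the complement of a
neighbourhood of its closure. -/
theorem exists_kernel_le_tailWeight (hps : 0 ≤ p * s) (hb : Bornology.IsBounded Ω) (hU : IsOpen U)
    (hΩU : closure Ω ⊆ U) :
    ∃ C : ℝ, 0 ≤ C ∧ ∀ x ∈ Ω, ∀ y ∉ U,
      (‖x - y‖ ^ ((N : ℝ) + p * s))⁻¹ ≤ C * tailWeight s p y := by
  obtain ⟨δ, hδ, hδU⟩ := hb.isCompact_closure.exists_thickening_subset_open hU hΩU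
  obtain ⟨R, hR⟩ := hb.exists_norm_le
  set D : ℝ := (1 + |R|) / δ + 1 with hD
  have hD0 : 0 < D := by positivity
  refine ⟨D ^ ((N : ℝ) + p * s), by positivity, fun x hx y hy => ?_⟩
  have hxy : δ ≤ ‖x - y‖ := by
    by_contra hc
    push Not at hc
    apply hy
    apply hδU
    rw [Metric.mem_thickening_iff]
    exact ⟨x, subset_closure hx, by rwa [dist_comm, dist_eq_norm]⟩
  have h1 : 1 + ‖y‖ ≤ D * ‖x - y‖ := by
    have h2 : ‖y‖ ≤ ‖x‖ + ‖x - y‖ := by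
      calc ‖y‖ = ‖x - (x - y)‖ := by simp
        _ ≤ _ := norm_sub_le _ _
    have h3 : ‖x‖ ≤ |R| := (hR x hx).trans (le_abs_self R)
    have h4 : 1 + |R| ≤ (1 + |R|) / δ * ‖x - y‖ := by
      rw [div_mul_eq_mul_div, le_div_iff₀ hδ]
      gcongr
    rw [hD]; linarith
  have hpos : 0 < ‖x - y‖ := hδ.trans_le hxy
  have h5 : (1 + ‖y‖) ^ ((N : ℝ) + p * s) ≤
      D ^ ((N : ℝ) + p * s) * ‖x - y‖ ^ ((N : ℝ) + p * s) := by
    rw [← Real.mul_rpow hD0.le hpos.le]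
    exact Real.rpow_le_rpow (by positivity) h1 (by positivity)
  unfold tailWeight
  rw [← div_eq_mul_inv, inv_eq_one_div, div_le_div_iff₀ (by positivity) (by positivity)]
  linarith

theorem integrable_of_ae_eq_zero_compl {g : RN N → ℝ} (hΩ : MeasurableSet Ω)
    (h0 : ∀ᵐ x, x ∉ Ω → g x = 0) (hg : IntegrableOn g Ω) : Integrable g := by
  rw [← integrable_indicator_iff hΩ] at hg
  refine hg.congr ?_
  filter_upwards [h0] with x hx
  by_cases h : x ∈ Ω
  · simp [h]
  · simp [h, hx h]

theorem integrable_indicator_prod {g : RN N × RN N → ℝ} (hU : MeasurableSet U)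
    (hg : Integrable g ((volume.restrict U).prod (volume.restrict U))) :
    Integrable ((U ×ˢ U).indicator g) := by
  rw [integrable_indicator_iff (hU.prod hU)]
  rwa [Measure.prod_restrict] at hg

/-- Extension by zero: a function that vanishes off `Ω` and has finite seminorm on a neighbourhood
of the closure of `Ω` has finite seminorm on the whole space. -/
theorem memW_univ_of_ae_eq_zero (hp : 0 < p) (hs : 0 < s) (hΩ : IsOpen Ω)
    (hb : Bornology.IsBounded Ω) (hU : IsOpen U) (hΩU : closure Ω ⊆ U)
    (hm : AEStronglyMeasurable v) (h0 : ∀ᵐ x, x ∉ Ω → v x = 0) (hv : MemW s p U v) :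
    MemW s p univ v := by
  have hsub : Ω ⊆ U := subset_closure.trans hΩU
  have hLp : MemLp v (ENNReal.ofReal p) := by
    have h := (hv.mono hsub).1
    rw [← memLp_indicator_iff_restrict hΩ.measurableSet] at h
    refine h.ae_eq ?_
    filter_upwards [h0] with x hx
    by_cases h : x ∈ Ω
    · simp [h]
    · simp [h, hx h]
  have hLp' : MemLp v (ENNReal.ofReal p) (volume.restrict univ) := by
    rwa [Measure.restrict_univ]
  refine ⟨hLp', ?_⟩
  rw [gagliardo_lt_top_iff hLp'.1, Measure.restrict_univ]
  have hvp : Integrable fun x => |v x| ^ p := by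
    have := hLp.integrable_norm_rpow (by simpa using hp) ENNReal.ofReal_ne_top
    simpa [ENNReal.toReal_ofReal hp.le] using this
  obtain ⟨C, hC, hker⟩ := exists_kernel_le_tailWeight (mul_pos hp hs).le hb hU hΩU
  have hk := integrable_tailWeight (N := N) (mul_pos hp hs)
  refine Integrable.mono' (g := fun z => (U ×ˢ U).indicator (energyDensity s p v) z +
      C * (|v z.1| ^ p * tailWeight s p z.2 + tailWeight s p z.1 * |v z.2| ^ p)) ?_
    (aestronglyMeasurable_energyDensity hm) ?_
  · exact (integrable_indicator_prod hU.measurableSet hv.integrable_energyDensity).add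
      (((hvp.mul_prod hk).add (hk.mul_prod hvp)).const_mul C)
  · filter_upwards [ae_prod_of_ae h0] with z hz
    rw [Real.norm_of_nonneg (energyDensity_nonneg z)]
    have hA : 0 ≤ (U ×ˢ U).indicator (energyDensity s p v) z :=
      indicator_nonneg (fun _ _ => energyDensity_nonneg _) _
    have hB : 0 ≤ |v z.1| ^ p * tailWeight s p z.2 :=
      mul_nonneg (by positivity) (tailWeight_nonneg _)
    have hB' : 0 ≤ tailWeight s p z.1 * |v z.2| ^ p :=
      mul_nonneg (tailWeight_nonneg _) (by positivity)
    have hBC := mul_nonneg hC hB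
    have hBC' := mul_nonneg hC hB'
    rw [mul_add]
    by_cases h1 : z.1 ∈ U
    · by_cases h2 : z.2 ∈ U
      · rw [indicator_of_mem (show z ∈ U ×ˢ U from ⟨h1, h2⟩)]
        linarith
      · have e2 : v z.2 = 0 := hz.2 fun h => h2 (hsub h)
        by_cases h3 : z.1 ∈ Ω
        · have := mul_le_mul_of_nonneg_left (hker _ h3 _ h2)
            (Real.rpow_nonneg (abs_nonneg (v z.1)) p)
          have e : energyDensity s p v z = |v z.1| ^ p * (‖z.1 - z.2‖ ^ ((N : ℝ) + p * s))⁻¹ := by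
            simp [energyDensity, e2, div_eq_mul_inv]
          rw [e]; linarith
        · have e : energyDensity s p v z = 0 := by
            simp [energyDensity, e2, hz.1 h3, Real.zero_rpow hp.ne']
          rw [e]; linarith
    · have e1 : v z.1 = 0 := hz.1 fun h => h1 (hsub h)
      by_cases h3 : z.2 ∈ Ω
      · have := mul_le_mul_of_nonneg_left (hker _ h3 _ h1)
          (Real.rpow_nonneg (abs_nonneg (v z.2)) p)
        have e : energyDensity s p v z = |v z.2| ^ p * (‖z.2 - z.1‖ ^ ((N : ℝ) + p * s))⁻¹ := by
          simp [energyDensity, e1, div_eq_mul_inv, norm_sub_rev z.1 z.2]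
        rw [e]; linarith
      · have e : energyDensity s p v z = 0 := by
          simp [energyDensity, e1, hz.2 h3, Real.zero_rpow hp.ne']
        rw [e]; linarith

theorem abs_pairingDensity (hp : 2 ≤ p) (z : RN N × RN N) :
    |pairingDensity s p u v z| =
      |u z.1 - u z.2| ^ (p - 1) * |v z.1 - v z.2| * (‖z.1 - z.2‖ ^ ((N : ℝ) + p * s))⁻¹ := by
  unfold pairingDensity
  rw [abs_div, abs_mul, abs_mul, abs_of_nonneg (a := _ ^ (p - 2)) (by positivity),
    abs_rpow_sub_two_mul_self hp, abs_of_nonneg (a := ‖z.1 - z.2‖ ^ _) (by positivity),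
    div_eq_mul_inv]

theorem abs_pairingDensity_le (hp : 2 ≤ p) (z : RN N × RN N) :
    |pairingDensity s p u v z| ≤ energyDensity s p u z + energyDensity s p v z := by
  rw [abs_pairingDensity hp]
  unfold energyDensity
  rw [← add_div, div_eq_mul_inv]
  gcongr
  exact rpow_sub_one_mul_le (abs_nonneg _) (abs_nonneg _) (by linarith)

theorem pairingDensity_swap (z : RN N × RN N) :
    |pairingDensity s p u v z.swap| = |pairingDensity s p u v z| := by
  unfold pairingDensity
  simp only [Prod.fst_swap, Prod.snd_swap]
  rw [norm_sub_rev z.2 z.1, abs_sub_comm (u z.2) (u z.1)]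
  congr 1
  ring

theorem abs_pairingDensity_le_of_notMem (hp : 2 ≤ p) {C : ℝ} (hC : 0 ≤ C)
    (hker : ∀ x ∈ Ω, ∀ y ∉ U, (‖x - y‖ ^ ((N : ℝ) + p * s))⁻¹ ≤ C * tailWeight s p y)
    {x y : RN N} (hy : y ∉ U) (hx0 : x ∉ Ω → v x = 0) (hy0 : v y = 0) :
    |pairingDensity s p u v (x, y)| ≤ C * 2 ^ p * (|u x| ^ (p - 1) * |v x| * tailWeight s p y +
      |v x| * (|u y| ^ (p - 1) * tailWeight s p y)) := by
  have hp1 : 0 ≤ p - 1 := by linarith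
  have hk := tailWeight_nonneg (s := s) (p := p) y
  by_cases hx : x ∈ Ω
  · rw [abs_pairingDensity hp]
    simp only [hy0, sub_zero]
    have h1 : |u x - u y| ^ (p - 1) ≤ 2 ^ p * (|u x| ^ (p - 1) + |u y| ^ (p - 1)) :=
      calc |u x - u y| ^ (p - 1) ≤ (|u x| + |u y|) ^ (p - 1) :=
            Real.rpow_le_rpow (abs_nonneg _) (abs_sub _ _) hp1
        _ ≤ 2 ^ (p - 1) * (|u x| ^ (p - 1) + |u y| ^ (p - 1)) :=
            add_rpow_le_two_rpow_mul (abs_nonneg _) (abs_nonneg _) hp1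
        _ ≤ _ := by
            gcongr
            · norm_num
            · linarith
    calc _ ≤ (2 ^ p * (|u x| ^ (p - 1) + |u y| ^ (p - 1))) * |v x| * (C * tailWeight s p y) := by
          gcongr
          exact hker _ hx _ hy
      _ = _ := by ring
  · have : pairingDensity s p u v (x, y) = 0 := by
      simp [pairingDensity, hy0, hx0 hx]
    rw [this, abs_zero]
    positivity

/-- The integrand of the pairing is integrable for `u` in the space `MemWTilde` and `v` in
`MemW0`. -/
theorem integrable_pairingDensity (hp : 2 ≤ p) (hs : 0 < s) (hΩ : IsOpen Ω)
    (hb : Bornology.IsBounded Ω) (hu : MemWTilde s p Ω u) (hv : MemW0 s p Ω v) :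
    Integrable (pairingDensity s p u v) := by
  have hp0 : 0 < p := by linarith
  obtain ⟨U, hU, hΩU, huU⟩ := hu.2.1
  have hsub : Ω ⊆ U := subset_closure.trans hΩU
  have h0 := hv.ae_eq_zero hΩ
  have hvU := hv.1.mono (subset_univ U)
  have hvΩ := hv.1.mono (subset_univ Ω)
  have huΩ := huU.mono hsub
  have hfin : IsFiniteMeasure (volume.restrict Ω) := ⟨by simpa using hb.measure_lt_top⟩
  have hv1 : Integrable fun x => |v x| := by
    apply integrable_of_ae_eq_zero_compl hΩ.measurableSet
    · filter_upwards [h0] with x hx h using by simp [hx h]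
    · exact (hvΩ.1.integrable (by simp; linarith)).abs
  have huv : Integrable fun x => |u x| ^ (p - 1) * |v x| := by
    apply integrable_of_ae_eq_zero_compl hΩ.measurableSet
    · filter_upwards [h0] with x hx h using by simp [hx h]
    · refine Integrable.mono' ((huΩ.integrable_rpow hp0).add (hvΩ.integrable_rpow hp0)) ?_
        (Filter.Eventually.of_forall fun x => ?_)
      · exact (((measurable_id.abs.pow_const (p - 1)).comp_aemeasurable
          huΩ.1.1.aemeasurable).mul hvΩ.1.1.aemeasurable.abs).aestronglyMeasurable
      · rw [Real.norm_of_nonneg (by positivity)]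
        exact rpow_sub_one_mul_le (abs_nonneg _) (abs_nonneg _) (by linarith)
  have hut := hu.integrable_tail
  have hk := integrable_tailWeight (N := N) (mul_pos hp0 hs)
  obtain ⟨C, hC, hker⟩ := exists_kernel_le_tailWeight (mul_pos hp0 hs).le hb hU hΩU
  set G : RN N × RN N → ℝ := fun z => C * 2 ^ p *
    (|u z.1| ^ (p - 1) * |v z.1| * tailWeight s p z.2 +
      |v z.1| * (|u z.2| ^ (p - 1) * tailWeight s p z.2)) with hG
  have hGint : Integrable G := ((huv.mul_prod hk).add (hv1.mul_prod hut)).const_mul _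
  have hG0 : ∀ z, 0 ≤ G z := fun z => by
    have := tailWeight_nonneg (s := s) (p := p) z.2
    positivity
  refine Integrable.mono' (g := fun z => (U ×ˢ U).indicator (fun z => energyDensity s p u z +
      energyDensity s p v z) z + (G z + G z.swap)) ?_
    (aestronglyMeasurable_pairingDensity hu.aestronglyMeasurable hv.aestronglyMeasurable) ?_
  · exact (integrable_indicator_prod hU.measurableSet
      (huU.integrable_energyDensity.add hvU.integrable_energyDensity)).add
      (hGint.add hGint.swap)
  · filter_upwards [ae_prod_of_ae h0] with z hz
    rw [Real.norm_eq_abs]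
    have hA : 0 ≤ (U ×ˢ U).indicator (fun z => energyDensity s p u z +
      energyDensity s p v z) z :=
      indicator_nonneg (fun _ _ => add_nonneg (energyDensity_nonneg _) (energyDensity_nonneg _)) _
    by_cases h1 : z.1 ∈ U
    · by_cases h2 : z.2 ∈ U
      · rw [indicator_of_mem (show z ∈ U ×ˢ U from ⟨h1, h2⟩)]
        linarith [abs_pairingDensity_le (s := s) (u := u) (v := v) hp z, hG0 z, hG0 z.swap]
      · have := abs_pairingDensity_le_of_notMem (u := u) hp hC hker h2 hz.1
          (hz.2 fun h => h2 (hsub h))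
        have e : |pairingDensity s p u v z| ≤ G z := this
        linarith [hG0 z.swap]
    · have := abs_pairingDensity_le_of_notMem (u := u) hp hC hker h1 hz.2
        (hz.1 fun h => h1 (hsub h))
      have e : |pairingDensity s p u v z.swap| ≤ G z.swap := this
      rw [pairingDensity_swap] at e
      linarith [hG0 z]

theorem MemW0.memWTilde (hp : 1 ≤ p) (hs : 0 < s) (hu : MemW0 s p Ω u) :
    MemWTilde s p Ω u := by
  have hp0 : 0 < p := by linarith
  refine ⟨fun K _ => (hu.1.mono (subset_univ K)).1, ⟨univ, isOpen_univ, subset_univ _, hu.1⟩, ?_⟩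
  have hup := hu.1.integrable_rpow hp0
  rw [Measure.restrict_univ] at hup
  have hint := (integrable_tailWeight (N := N) (mul_pos hp0 hs)).add hup
  refine lt_of_le_of_lt (lintegral_mono fun x => ENNReal.ofReal_le_ofReal ?_)
    ((hasFiniteIntegral_iff_ofReal (Filter.Eventually.of_forall fun x => ?_)).1 hint.2)
  · have h1 : |u x| ^ (p - 1) ≤ 1 + |u x| ^ p :=
      rpow_le_one_add_rpow (abs_nonneg _) (by linarith) (by linarith)
    have h2 : tailWeight s p x ≤ 1 := by
      unfold tailWeight
      apply inv_le_one_of_one_le₀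
      apply Real.one_le_rpow (by linarith [norm_nonneg x])
      have := mul_pos hp0 hs
      positivity
    have h3 := tailWeight_nonneg (s := s) (p := p) x
    calc |u x| ^ (p - 1) / (1 + ‖x‖) ^ ((N : ℝ) + p * s)
        = |u x| ^ (p - 1) * tailWeight s p x := by rw [div_eq_mul_inv]; rfl
      _ ≤ (1 + |u x| ^ p) * tailWeight s p x := by gcongr
      _ ≤ tailWeight s p x + |u x| ^ p := by
          have := mul_le_mul_of_nonneg_left h2 (Real.rpow_nonneg (abs_nonneg (u x)) p)
          linarith
  · exact add_nonneg (tailWeight_nonneg x) (by positivity)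

/-! ### Truncation -/

/-- Truncation of a function of `W^{s,p}_0(Ω)` from above by a function that is nonnegative off
`Ω`. -/
theorem MemW0.inf (hp : 2 ≤ p) (hs : 0 < s) (hΩ : IsOpen Ω) (hb : Bornology.IsBounded Ω)
    (hu : MemW0 s p Ω u) (hw : MemWTilde s p Ω w) (hw0 : ∀ᵐ x ∂(volume.restrict Ωᶜ), 0 ≤ w x) :
    MemW0 s p Ω (fun x => min (u x) (w x)) := by
  have hp0 : 0 < p := by linarith
  obtain ⟨U, hU, hΩU, hwU⟩ := hw.2.1
  have h0 : ∀ᵐ x ∂(volume.restrict Ωᶜ), min (u x) (w x) = 0 := by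
    filter_upwards [hu.2, hw0] with x h1 h2
    rw [h1, min_eq_left h2]
  refine ⟨memW_univ_of_ae_eq_zero hp0 hs hΩ hb hU hΩU
    (hu.aestronglyMeasurable.inf hw.aestronglyMeasurable) ?_
    ((hu.1.mono (subset_univ U)).inf hp0 hwU), h0⟩
  rwa [ae_restrict_iff' hΩ.measurableSet.compl] at h0

/-- Truncation from above lowers the energy by at least `p ⟨(-Δ)_p^s w, u - min u w⟩`. -/
theorem energy_min_le (hp : 2 ≤ p) (hs : 0 < s) (hΩ : IsOpen Ω) (hb : Bornology.IsBounded Ω)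
    (hu : MemW0 s p Ω u) (hw : MemWTilde s p Ω w) (hw0 : ∀ᵐ x ∂(volume.restrict Ωᶜ), 0 ≤ w x) :
    p * pairing s p w (fun x => u x - min (u x) (w x)) +
      energy s p (fun x => min (u x) (w x)) ≤ energy s p u := by
  have hp0 : 0 < p := by linarith
  have hm := hu.inf hp hs hΩ hb hw hw0
  have hI := integrable_pairingDensity hp hs hΩ hb hw (hu.sub hp0 hm)
  have hE := memW_univ_integrable_energyDensity hm.1
  unfold energy
  rw [show pairing s p w (fun x => u x - min (u x) (w x)) =
    ∫ z, pairingDensity s p w (fun x => u x - min (u x) (w x)) z from rfl,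
    ← integral_const_mul, ← integral_add (hI.const_mul p) hE]
  refine integral_mono ((hI.const_mul p).add hE) (memW_univ_integrable_energyDensity hu.1)
    fun z => ?_
  have h := div_le_div_of_nonneg_right (min_energy_le hp (u z.1) (u z.2) (w z.1) (w z.2))
    (Real.rpow_nonneg (norm_nonneg (z.1 - z.2)) ((N : ℝ) + p * s))
  simp only [pairingDensity, energyDensity]
  rw [mul_div_assoc, sub_div] at h
  linarith

theorem energy_neg : energy s p (fun x => -u x) = energy s p u := by
  unfold energy energyDensity
  congr 1 with z
  rw [neg_sub_neg, abs_sub_comm]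

theorem pairing_neg_left : pairing s p (fun x => -u x) v = -pairing s p u v := by
  unfold pairing
  rw [← integral_neg]
  congr 1 with z
  rw [neg_sub_neg, abs_sub_comm]
  ring

theorem gagliardo_neg : gagliardo s p U (fun x => -u x) = gagliardo s p U u := by
  unfold gagliardo
  congr 1 with z
  rw [neg_sub_neg, abs_sub_comm]

theorem MemWTilde.neg (hu : MemWTilde s p Ω u) : MemWTilde s p Ω (fun x => -u x) := by
  obtain ⟨h1, ⟨U, hU, hΩU, h2⟩, h3⟩ := hu
  refine ⟨fun K hK => (h1 K hK).neg, ⟨U, hU, hΩU, h2.1.neg, ?_⟩, by simpa using h3⟩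
  rw [gagliardo_neg]; exact h2.2

/-- Truncation of a function of `W^{s,p}_0(Ω)` from below by a function that is nonpositive off
`Ω`. -/
theorem MemW0.sup (hp : 2 ≤ p) (hs : 0 < s) (hΩ : IsOpen Ω) (hb : Bornology.IsBounded Ω)
    (hu : MemW0 s p Ω u) (hw : MemWTilde s p Ω w) (hw0 : ∀ᵐ x ∂(volume.restrict Ωᶜ), w x ≤ 0) :
    MemW0 s p Ω (fun x => max (u x) (w x)) := by
  have hp0 : 0 < p := by linarith
  have := ((hu.neg hp0).inf hp hs hΩ hb hw.neg
    (by filter_upwards [hw0] with x hx using by linarith)).neg hp0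
  simpa only [min_neg_neg, neg_neg] using this

/-- Truncation from below lowers the energy by at least `p ⟨(-Δ)_p^s w, u - max u w⟩`. -/
theorem energy_max_le (hp : 2 ≤ p) (hs : 0 < s) (hΩ : IsOpen Ω) (hb : Bornology.IsBounded Ω)
    (hu : MemW0 s p Ω u) (hw : MemWTilde s p Ω w) (hw0 : ∀ᵐ x ∂(volume.restrict Ωᶜ), w x ≤ 0) :
    energy s p (fun x => max (u x) (w x)) ≤
      energy s p u + p * pairing s p w (fun x => max (u x) (w x) - u x) := by
  have hp0 : 0 < p := by linarith
  have := energy_min_le hp hs hΩ hb (hu.neg hp0) hw.neg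
    (by filter_upwards [hw0] with x hx using by linarith)
  simp only [min_neg_neg, energy_neg] at this
  rw [pairing_neg_left] at this
  have e : (fun x => -u x - -max (u x) (w x)) = fun x => max (u x) (w x) - u x := by
    ext x; ring
  rw [e] at this
  linarith

/-! ### Subcritical integrability -/

theorem volume_real_ball (hN : 0 < N) (x : RN N) {r : ℝ} (hr : 0 ≤ r) :
    volume.real (Metric.ball x r) = r ^ (N : ℝ) * volume.real (Metric.ball (0 : RN N) 1) := by
  have : Nonempty (Fin N) := ⟨⟨0, hN⟩⟩
  unfold Measure.real
  rw [Measure.addHaar_ball volume x hr, ENNReal.toReal_mul, ENNReal.toReal_ofReal (by positivity)]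
  simp

theorem volume_real_unit_ball_pos : 0 < volume.real (Metric.ball (0 : RN N) 1) :=
  ENNReal.toReal_pos (Metric.measure_ball_pos volume _ one_pos).ne' measure_ball_lt_top.ne

/-- The pointwise bound behind the gain of integrability. If the value `2λ` of `|u|` at `x` is
large, then `|u|` is below `λ` on at least half of a ball around `x` of volume `2 M λ ^ -m`, and
the differences `|u x - u y|` over that half are controlled by the density `G` of the seminorm. -/
theorem rpow_le_of_integral_ball_le (hN : 0 < N) (hp : 0 < p) (hs : 0 < s) {m M K l ε G ω : ℝ}
    (hm : 0 < m) (hM : 0 < M) (hω : 0 < ω) (hK : K = 2 * M / ω) (hl : 0 < l) (hε : 0 < ε)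
    (hG : 0 ≤ G)
    (h : ∀ r, 0 < r → r ≤ ε →
      l ^ p * (r ^ (N : ℝ) * ω) ≤ r ^ ((N : ℝ) + p * s) * G + l ^ (p - m) * M) :
    l ^ (p + m * (p * s / N)) ≤
      (K / ε ^ (N : ℝ)) ^ ((p + m * (p * s / N)) / m) + K ^ (1 + p * s / N) / M * G := by
  have hN' : (0 : ℝ) < N := by exact_mod_cast hN
  have hK0 : 0 < K := by rw [hK]; positivity
  set e := p + m * (p * s / N) with he
  have he0 : 0 < e := by positivity
  set R := K * l ^ (-m) with hR
  have hR0 : 0 < R := by positivity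
  set r := R ^ (1 / (N : ℝ)) with hr
  have hr0 : 0 < r := by positivity
  have hrN : r ^ (N : ℝ) = R := by
    rw [hr, ← Real.rpow_mul hR0.le, one_div_mul_cancel hN'.ne', Real.rpow_one]
  have hlm : 0 < l ^ m := by positivity
  rcases le_or_gt r ε with hrε | hrε
  · have h1 := h r hr0 hrε
    have e1 : r ^ ((N : ℝ) + p * s) = K ^ (1 + p * s / N) * l ^ (-(m * (1 + p * s / N))) := by
      have : (N : ℝ) + p * s = N * (1 + p * s / N) := by field_simp
      rw [this, Real.rpow_mul hr0.le, hrN, hR, Real.mul_rpow hK0.le (by positivity),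
        ← Real.rpow_mul hl.le]
      congr 2; ring
    have e2 : l ^ p * (r ^ (N : ℝ) * ω) = 2 * M * l ^ (p - m) := by
      rw [hrN, hR, hK, Real.rpow_sub hl, Real.rpow_neg hl.le]
      field_simp
    rw [e1, e2] at h1
    have h2 : M * l ^ (p - m) ≤ K ^ (1 + p * s / N) * l ^ (-(m * (1 + p * s / N))) * G := by
      linarith
    have h3 : l ^ e ≤ K ^ (1 + p * s / N) / M * G := by
      have e3 : l ^ e = l ^ (p - m) * l ^ (m * (1 + p * s / N)) := by
        rw [← Real.rpow_add hl, he]; congr 1; ring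
      have h4 := mul_le_mul_of_nonneg_right h2
        (Real.rpow_nonneg hl.le (m * (1 + p * s / N)))
      rw [Real.rpow_neg hl.le] at h4
      have hx : 0 < l ^ (m * (1 + p * s / N)) := by positivity
      have e4 : K ^ (1 + p * s / N) * (l ^ (m * (1 + p * s / N)))⁻¹ * G *
          l ^ (m * (1 + p * s / N)) = K ^ (1 + p * s / N) * G := by
        field_simp
      rw [e4] at h4
      rw [e3, div_mul_eq_mul_div, le_div_iff₀ hM]
      linarith
    have : 0 ≤ (K / ε ^ (N : ℝ)) ^ (e / m) := by positivity
    linarith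
  · have h1 : ε ^ (N : ℝ) ≤ R := by
      rw [← hrN]; exact Real.rpow_le_rpow hε.le hrε.le hN'.le
    have h2 : l ^ m ≤ K / ε ^ (N : ℝ) := by
      rw [le_div_iff₀ (by positivity)]
      calc l ^ m * ε ^ (N : ℝ) ≤ l ^ m * R := by gcongr
        _ = K := by rw [hR, Real.rpow_neg hl.le]; field_simp
    have h3 : l ^ e ≤ (K / ε ^ (N : ℝ)) ^ (e / m) := by
      calc l ^ e = (l ^ m) ^ (e / m) := by
            rw [← Real.rpow_mul hl.le]; congr 1; field_simp
        _ ≤ _ := Real.rpow_le_rpow hlm.le h2 (by positivity)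
    have : 0 ≤ K ^ (1 + p * s / N) / M * G := by positivity
    linarith

/-- One step of the gain of integrability: from the exponent `m` on a neighbourhood of `V` to the
exponent `p + m * (p * s / N)` on `V`. -/
theorem integrableOn_rpow_step (hN : 0 < N) (hp : 1 ≤ p) (hs : 0 < s)
    (hu : MemW s p U u) (hV : MeasurableSet V) (hb : Bornology.IsBounded V) {ε : ℝ} (hε : 0 < ε)
    (hVU : Metric.thickening ε V ⊆ U) {m : ℝ} (hm : 0 < m)
    (hint : IntegrableOn (fun x => |u x| ^ m) (Metric.thickening ε V)) :
    IntegrableOn (fun x => |u x| ^ (p + m * (p * s / N))) V := by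
  have hp0 : 0 < p := by linarith
  have hN' : (0 : ℝ) < N := by exact_mod_cast hN
  set W := Metric.thickening ε V with hW
  have hVW : V ⊆ W := Metric.self_subset_thickening hε V
  have hWm : MeasurableSet W := Metric.isOpen_thickening.measurableSet
  set ω := volume.real (Metric.ball (0 : RN N) 1) with hω
  have hω0 : 0 < ω := volume_real_unit_ball_pos
  set M := 1 + ∫ x in W, |u x| ^ m with hM
  have hM0 : 0 < M := by
    have : 0 ≤ ∫ x in W, |u x| ^ m := integral_nonneg fun x => by positivity
    linarith
  set e := p + m * (p * s / N) with he
  have he0 : 0 < e := by positivity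
  set K := 2 * M / ω with hK
  set G : RN N → ℝ := fun x => ∫ y in U, energyDensity s p u (x, y) with hG
  have hGint : Integrable G (volume.restrict U) := hu.integrable_energyDensity.integral_prod_left
  have hG0 : ∀ x, 0 ≤ G x := fun x => integral_nonneg fun y => energyDensity_nonneg _
  have hae : ∀ᵐ x ∂(volume.restrict U),
      Integrable (fun y => energyDensity s p u (x, y)) (volume.restrict U) :=
    hu.integrable_energyDensity.prod_right_ae
  have hfin : IsFiniteMeasure (volume.restrict V) := ⟨by simpa using hb.measure_lt_top⟩
  set L := (K / ε ^ (N : ℝ)) ^ (e / m) with hL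
  have hL0 : 0 ≤ L := by positivity
  have hV1 : volume.restrict V ≤ volume.restrict U :=
    Measure.restrict_mono (hVW.trans hVU) le_rfl
  refine Integrable.mono' (g := fun x => 2 ^ e * (L + K ^ (1 + p * s / N) / M * G x)) ?_ ?_ ?_
  · exact ((integrable_const L).add ((hGint.mono_measure hV1).const_mul _)).const_mul _
  · exact ((measurable_id.abs.pow_const e).comp_aemeasurable
      (hu.1.1.mono_measure hV1).aemeasurable).aestronglyMeasurable
  filter_upwards [ae_mono hV1 hae, ae_restrict_mem hV] with x hx hxV
  rw [Real.norm_of_nonneg (by positivity)]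
  rcases (abs_nonneg (u x)).eq_or_lt with h0 | h0
  · rw [← h0, Real.zero_rpow he0.ne']
    have := hG0 x
    positivity
  set l := |u x| / 2 with hl
  have hl0 : 0 < l := by positivity
  have key := rpow_le_of_integral_ball_le (G := G x) hN hp0 hs hm hM0 hω0 hK hl0 hε (hG0 x) ?_
  · have : |u x| = 2 * l := by rw [hl]; ring
    rw [this, Real.mul_rpow (by norm_num) hl0.le]
    gcongr
  intro r hr hrε
  have hBW : Metric.ball x r ⊆ W := fun y hy =>
    Metric.mem_thickening_iff.2 ⟨x, hxV, (Metric.mem_ball.1 hy).trans_le hrε⟩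
  have hBU := hBW.trans hVU
  have hBU1 : volume.restrict (Metric.ball x r) ≤ volume.restrict U :=
    Measure.restrict_mono hBU le_rfl
  have hpt : ∀ y ∈ Metric.ball x r, l ^ p ≤ r ^ ((N : ℝ) + p * s) * energyDensity s p u (x, y) +
      l ^ (p - m) * |u y| ^ m := by
    intro y hy
    have hE := energyDensity_nonneg (s := s) (p := p) (u := u) (x, y)
    rcases le_or_gt |u y| l with h | h
    · have h1 : l ≤ |u x - u y| := by
        have := abs_sub_abs_le_abs_sub (u x) (u y)
        linarith
      have h2 : |u x - u y| ^ p ≤ r ^ ((N : ℝ) + p * s) * energyDensity s p u (x, y) := by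
        have hne : x ≠ y := by
          rintro rfl
          rw [sub_self, abs_zero] at h1; linarith
        have hd : 0 < ‖x - y‖ := norm_pos_iff.2 (sub_ne_zero.2 hne)
        have hdr : ‖x - y‖ ≤ r := by
          rw [← dist_eq_norm, dist_comm]; exact (Metric.mem_ball.1 hy).le
        unfold energyDensity
        rw [← mul_div_assoc, le_div_iff₀ (by positivity), mul_comm]
        gcongr
      have h3 := Real.rpow_le_rpow hl0.le h1 hp0.le
      have : 0 ≤ l ^ (p - m) * |u y| ^ m := by positivity
      linarith
    · have h1 : l ^ p ≤ l ^ (p - m) * |u y| ^ m := by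
        calc l ^ p = l ^ (p - m) * l ^ m := by rw [← Real.rpow_add hl0]; congr 1; ring
          _ ≤ _ := by gcongr
      have : 0 ≤ r ^ ((N : ℝ) + p * s) * energyDensity s p u (x, y) := by positivity
      linarith
  have hi1 : IntegrableOn (fun y => r ^ ((N : ℝ) + p * s) * energyDensity s p u (x, y))
      (Metric.ball x r) := (hx.mono_measure hBU1).const_mul _
  have hi2 : IntegrableOn (fun y => l ^ (p - m) * |u y| ^ m) (Metric.ball x r) :=
    (hint.mono_set hBW).const_mul _
  have h1 := setIntegral_mono_on (integrableOn_const measure_ball_lt_top.ne) (hi1.add hi2)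
    measurableSet_ball hpt
  simp only [Pi.add_apply] at h1
  rw [integral_add hi1 hi2, integral_const_mul, integral_const_mul, setIntegral_const, smul_eq_mul,
    volume_real_ball hN x hr.le] at h1
  have h2 : ∫ y in Metric.ball x r, energyDensity s p u (x, y) ≤ G x :=
    setIntegral_mono_set hx (Filter.Eventually.of_forall fun y => energyDensity_nonneg _)
      hBU.eventuallyLE
  have h3 : ∫ y in Metric.ball x r, |u y| ^ m ≤ M := by
    have := setIntegral_mono_set hint (Filter.Eventually.of_forall fun y => by positivity)
      hBW.eventuallyLE
    linarith
  calc l ^ p * (r ^ (N : ℝ) * ω) = r ^ (N : ℝ) * ω * l ^ p := mul_comm _ _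
    _ ≤ _ := h1
    _ ≤ _ := by gcongr

/-- The exponents `p* (1 - (ps/N)^(k+1))`, where `p* = Np/(N - ps)`, start at `p` and are produced
by iterating the gain of integrability. -/
theorem integrableOn_rpow_iterate (hN : 0 < N) (hp : 1 ≤ p) (hs : 0 < s) (hps : p * s < N)
    (hu : MemW s p U u) (k : ℕ) :
    ∀ V : Set (RN N), MeasurableSet V → Bornology.IsBounded V →
      (∃ ε : ℝ, 0 < ε ∧ Metric.thickening ε V ⊆ U) →
      IntegrableOn (fun x =>
        |u x| ^ ((N : ℝ) * p / (N - p * s) * (1 - (p * s / N) ^ (k + 1)))) V := by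
  have hp0 : 0 < p := by linarith
  have hN' : (0 : ℝ) < N := by exact_mod_cast hN
  have hd : 0 < (N : ℝ) - p * s := by linarith
  have hA0 : 0 < p * s / N := by positivity
  have hA1 : p * s / N < 1 := by rwa [div_lt_one hN']
  induction k with
  | zero =>
    rintro V - - ⟨ε, hε, hVU⟩
    have e : (N : ℝ) * p / (N - p * s) * (1 - (p * s / N) ^ (0 + 1)) = p := by
      rw [zero_add, pow_one, one_sub_div hN'.ne']
      field_simp
    rw [e]
    exact (hu.mono ((Metric.self_subset_thickening hε V).trans hVU)).integrable_rpow hp0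
  | succ k ih =>
    rintro V hV hb ⟨ε, hε, hVU⟩
    have hsub : Metric.thickening (ε / 2) (Metric.thickening (ε / 2) V) ⊆ U := by
      refine (Metric.thickening_thickening_subset _ _ _).trans ?_
      rwa [add_halves]
    have h1 := ih (Metric.thickening (ε / 2) V) Metric.isOpen_thickening.measurableSet
      hb.thickening ⟨ε / 2, by positivity, hsub⟩
    have hm : 0 < (N : ℝ) * p / (N - p * s) * (1 - (p * s / N) ^ (k + 1)) := by
      have : (p * s / N) ^ (k + 1) < 1 := pow_lt_one₀ hA0.le hA1 (by simp)
      have : 0 < 1 - (p * s / N) ^ (k + 1) := by linarith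
      positivity
    have h2 := integrableOn_rpow_step hN hp hs hu hV hb (half_pos hε)
      ((Metric.thickening_mono (by linarith) V).trans hVU) hm h1
    have e : p + (N : ℝ) * p / (N - p * s) * (1 - (p * s / N) ^ (k + 1)) * (p * s / N) =
        (N : ℝ) * p / (N - p * s) * (1 - (p * s / N) ^ (k + 1 + 1)) := by
      have e1 : (p * s / N) ^ (k + 1 + 1) = (p * s / N) ^ (k + 1) * (p * s / N) := pow_succ _ _
      rw [e1]
      generalize (p * s / N) ^ (k + 1) = X
      field_simp
      ring
    rwa [e] at h2

/-- The subcritical Sobolev embedding in qualitative form: functions of `W^{s,p}(U)` are locally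
in `L^q` for `q < p*`. -/
theorem MemW.integrableOn_rpow (hN : 0 < N) (hp : 1 ≤ p) (hs : 0 < s) (hps : p * s < N)
    (hu : MemW s p U u) (hV : MeasurableSet V) (hb : Bornology.IsBounded V)
    (hVU : ∃ ε : ℝ, 0 < ε ∧ Metric.thickening ε V ⊆ U) {q : ℝ} (hq : 0 ≤ q)
    (hqp : q < (N : ℝ) * p / (N - p * s)) : IntegrableOn (fun x => |u x| ^ q) V := by
  have hp0 : 0 < p := by linarith
  have hN' : (0 : ℝ) < N := by exact_mod_cast hN
  have hd : 0 < (N : ℝ) - p * s := by linarith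
  have hA0 : 0 < p * s / N := by positivity
  have hA1 : p * s / N < 1 := by rwa [div_lt_one hN']
  have hP : 0 < (N : ℝ) * p / (N - p * s) := by positivity
  obtain ⟨k, hk⟩ := exists_pow_lt_of_lt_one
    (show 0 < 1 - q / ((N : ℝ) * p / (N - p * s)) by
      rw [sub_pos, div_lt_one hP]; exact hqp) hA1
  have hk' : (p * s / N) ^ (k + 1) ≤ (p * s / N) ^ k :=
    pow_le_pow_of_le_one hA0.le hA1.le (by omega)
  have hqk : q ≤ (N : ℝ) * p / (N - p * s) * (1 - (p * s / N) ^ (k + 1)) := by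
    rw [← div_le_iff₀' hP]; linarith
  have h1 := integrableOn_rpow_iterate hN hp hs hps hu k V hV hb hVU
  have hfin : IsFiniteMeasure (volume.restrict V) := ⟨by simpa using hb.measure_lt_top⟩
  obtain ⟨ε, hε, hVU⟩ := hVU
  refine Integrable.mono' ((integrable_const (1 : ℝ)).add h1) ?_
    (Filter.Eventually.of_forall fun x => ?_)
  · exact ((measurable_id.abs.pow_const q).comp_aemeasurable (hu.mono
      ((Metric.self_subset_thickening hε V).trans hVU)).1.1.aemeasurable).aestronglyMeasurable
  · rw [Real.norm_of_nonneg (by positivity)]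
    exact rpow_le_one_add_rpow (abs_nonneg _) hq hqk

theorem MemWTilde.integrableOn_rpow (hN : 0 < N) (hp : 1 ≤ p) (hs : 0 < s) (hps : p * s < N)
    (hΩ : IsOpen Ω) (hb : Bornology.IsBounded Ω) (hu : MemWTilde s p Ω u) {q : ℝ} (hq : 0 ≤ q)
    (hqp : q < (N : ℝ) * p / (N - p * s)) : IntegrableOn (fun x => |u x| ^ q) Ω := by
  obtain ⟨U, hU, hΩU, huU⟩ := hu.2.1
  obtain ⟨δ, hδ, hδU⟩ := hb.isCompact_closure.exists_thickening_subset_open hU hΩU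
  exact huU.integrableOn_rpow hN hp hs hps hΩ.measurableSet hb
    ⟨δ, hδ, (Metric.thickening_subset_of_subset δ subset_closure).trans hδU⟩ hq hqp

/-! ### Compactness -/

theorem le_add_rpow_mul_rpow {a η p : ℝ} (ha : 0 ≤ a) (hη : 0 < η) (hp : 1 ≤ p) :
    a ≤ η + η ^ (1 - p) * a ^ p := by
  rcases le_or_gt a η with h | h
  · have : 0 ≤ η ^ (1 - p) * a ^ p := by positivity
    linarith
  · have ha0 : 0 < a := hη.trans h
    have h1 : a ^ (1 - p) ≤ η ^ (1 - p) :=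
      Real.rpow_le_rpow_of_nonpos hη h.le (by linarith)
    calc a = a ^ (1 - p) * a ^ p := by rw [← Real.rpow_add ha0]; simp
      _ ≤ η ^ (1 - p) * a ^ p := by gcongr
      _ ≤ _ := by linarith

/-- A function of small oscillation energy is close in `L^1(Ω)` to its averages over balls of
radius `δ`, centred at points `c (i x)` of a countable family that are `δ`-close to `x`. -/
theorem setIntegral_abs_sub_average_le (hN : 0 < N) (hp : 1 ≤ p) (hs : 0 < s)
    (hb : Bornology.IsBounded Ω) (hu : Integrable u)
    (hE : Integrable (energyDensity s p u)) {δ η : ℝ} (hδ : 0 < δ) (hη : 0 < η)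
    (c : ℕ → RN N) (i : RN N → ℕ) (hi : Measurable i) (hc : ∀ x, dist x (c (i x)) < δ) :
    IntegrableOn (fun x => |u x - (∫ y in Metric.ball (c (i x)) δ, u y) /
        (δ ^ (N : ℝ) * volume.real (Metric.ball (0 : RN N) 1))|) Ω ∧
    ∫ x in Ω, |u x - (∫ y in Metric.ball (c (i x)) δ, u y) /
        (δ ^ (N : ℝ) * volume.real (Metric.ball (0 : RN N) 1))| ≤
      η * volume.real Ω + η ^ (1 - p) * (2 ^ ((N : ℝ) + p * s) * δ ^ (p * s) /
        volume.real (Metric.ball (0 : RN N) 1)) * energy s p u := by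
  have hp0 : 0 < p := by linarith
  set ω := volume.real (Metric.ball (0 : RN N) 1) with hω
  have hω0 : 0 < ω := volume_real_unit_ball_pos
  set β := δ ^ (N : ℝ) * ω with hβ
  have hβ0 : 0 < β := by positivity
  set A := η ^ (1 - p) * (2 ^ ((N : ℝ) + p * s) * δ ^ (p * s) / ω) with hA
  have hA0 : 0 ≤ A := by positivity
  have hfin : IsFiniteMeasure (volume.restrict Ω) := ⟨by simpa using hb.measure_lt_top⟩
  set G : RN N → ℝ := fun x => ∫ y, energyDensity s p u (x, y) with hG
  have hGint : Integrable G := hE.integral_prod_left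
  have hG0 : ∀ x, 0 ≤ G x := fun x => integral_nonneg fun y => energyDensity_nonneg _
  have hae : ∀ᵐ x, Integrable (fun y => energyDensity s p u (x, y)) := hE.prod_right_ae
  have hGE : ∫ x, G x = energy s p u := (integral_prod _ hE).symm
  have hpt : ∀ᵐ x, |u x - (∫ y in Metric.ball (c (i x)) δ, u y) / β| ≤ η + A * G x := by
    filter_upwards [hae] with x hx
    set B := Metric.ball (c (i x)) δ with hB
    have hBvol : volume.real B = β := volume_real_ball hN _ hδ.le
    have hBfin : volume B ≠ ∞ := measure_ball_lt_top.ne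
    have hcu : IntegrableOn (fun _ => u x) B := integrableOn_const hBfin
    have e1 : u x - (∫ y in B, u y) / β = (∫ y in B, (u x - u y)) / β := by
      rw [integral_sub hcu hu.integrableOn, setIntegral_const, hBvol, smul_eq_mul]
      field_simp
    have hpt : ∀ y ∈ B, |u x - u y| ≤
        η + η ^ (1 - p) * ((2 * δ) ^ ((N : ℝ) + p * s) * energyDensity s p u (x, y)) := by
      intro y hy
      refine (le_add_rpow_mul_rpow (abs_nonneg _) hη hp).trans ?_
      gcongr
      rcases eq_or_ne x y with rfl | hxy
      · rw [sub_self, abs_zero, Real.zero_rpow hp0.ne']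
        exact mul_nonneg (by positivity) (energyDensity_nonneg _)
      have hd : 0 < ‖x - y‖ := norm_pos_iff.2 (sub_ne_zero.2 hxy)
      have hdr : ‖x - y‖ ≤ 2 * δ := by
        rw [← dist_eq_norm]
        have h1 := dist_triangle x (c (i x)) y
        have h2 := hc x
        have h3 := Metric.mem_ball'.1 hy
        linarith
      unfold energyDensity
      rw [← mul_div_assoc, le_div_iff₀ (by positivity), mul_comm]
      have : 0 ≤ (N : ℝ) + p * s := by positivity
      gcongr
    have hi1 : IntegrableOn (fun y => |u x - u y|) B := (hcu.sub hu.integrableOn).abs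
    have hi2 : IntegrableOn (fun y => η ^ (1 - p) *
        ((2 * δ) ^ ((N : ℝ) + p * s) * energyDensity s p u (x, y))) B :=
      ((hx.const_mul _).const_mul _).integrableOn
    have hi3 : IntegrableOn (fun _ : RN N => η) B := integrableOn_const hBfin
    have h1 := setIntegral_mono_on hi1 (hi3.add hi2) measurableSet_ball hpt
    simp only [Pi.add_apply] at h1
    rw [integral_add hi3 hi2, integral_const_mul, integral_const_mul, setIntegral_const,
      hBvol, smul_eq_mul] at h1
    have h2 : ∫ y in B, energyDensity s p u (x, y) ≤ G x :=
      setIntegral_le_integral hx (Filter.Eventually.of_forall fun y => energyDensity_nonneg _)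
    rw [e1, abs_div, abs_of_pos hβ0, div_le_iff₀ hβ0]
    calc |∫ y in B, (u x - u y)| ≤ ∫ y in B, |u x - u y| := abs_integral_le_integral_abs
      _ ≤ β * η + η ^ (1 - p) * ((2 * δ) ^ ((N : ℝ) + p * s) *
            ∫ y in B, energyDensity s p u (x, y)) := h1
      _ ≤ β * η + η ^ (1 - p) * ((2 * δ) ^ ((N : ℝ) + p * s) * G x) := by gcongr
      _ = (η + A * G x) * β := by
        rw [hA, hβ, Real.mul_rpow (by norm_num) hδ.le, Real.rpow_add hδ]
        field_simp
  have hgint : IntegrableOn (fun x => η + A * G x) Ω :=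
    (integrable_const η).add (hGint.const_mul A).integrableOn
  have hmeas : AEStronglyMeasurable
      (fun x => |u x - (∫ y in Metric.ball (c (i x)) δ, u y) / β|) (volume.restrict Ω) := by
    have h1 : Measurable fun x => (∫ y in Metric.ball (c (i x)) δ, u y) / β :=
      (measurable_from_nat (f := fun n => (∫ y in Metric.ball (c n) δ, u y) / β)).comp hi
    exact (hu.1.sub h1.aestronglyMeasurable).norm.restrict
  have hint : IntegrableOn (fun x => |u x - (∫ y in Metric.ball (c (i x)) δ, u y) / β|) Ω := by
    refine Integrable.mono' hgint hmeas ?_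
    filter_upwards [ae_restrict_of_ae hpt] with x hx
    rwa [Real.norm_of_nonneg (abs_nonneg _)]
  refine ⟨hint, ?_⟩
  calc _ ≤ ∫ x in Ω, (η + A * G x) := setIntegral_mono_ae hint hgint hpt
    _ = η * volume.real Ω + A * ∫ x in Ω, G x := by
      rw [integral_add (integrable_const η) (hGint.const_mul A).integrableOn, integral_const_mul,
        setIntegral_const, smul_eq_mul, mul_comm]
    _ ≤ η * volume.real Ω + A * energy s p u := by
      rw [← hGE]
      have := setIntegral_le_integral (s := Ω) hGint (Filter.Eventually.of_forall hG0)
      gcongr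

theorem exists_measurable_index (δ : ℝ) (hδ : 0 < δ) :
    ∃ i : RN N → ℕ, Measurable i ∧
      ∀ x, dist x (TopologicalSpace.denseSeq (RN N) (i x)) < δ := by
  classical
  have hex : ∀ x : RN N, ∃ n, dist x (TopologicalSpace.denseSeq (RN N) n) < δ := fun x => by
    obtain ⟨n, hn⟩ := (TopologicalSpace.denseRange_denseSeq (RN N)).exists_dist_lt x hδ
    exact ⟨n, hn⟩
  refine ⟨fun x => Nat.find (hex x), measurable_find hex fun k => ?_, fun x => Nat.find_spec (hex x)⟩
  exact measurableSet_lt (by fun_prop) measurable_const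

/-- Compactness: a sequence that is bounded in `L^1` and in energy has a subsequence that
converges a.e. in `Ω`. -/
theorem exists_subseq_tendsto_ae (hN : 0 < N) (hp : 1 ≤ p) (hs : 0 < s)
    (hb : Bornology.IsBounded Ω) (u : ℕ → RN N → ℝ)
    (hu : ∀ n, Integrable (u n)) (hE : ∀ n, Integrable (energyDensity s p (u n)))
    {D M : ℝ} (hD : ∀ n, ∫ x, |u n x| ≤ D) (hM : ∀ n, energy s p (u n) ≤ M) :
    ∃ (φ : ℕ → ℕ) (f : RN N → ℝ), StrictMono φ ∧
      ∀ᵐ x ∂(volume.restrict Ω), Filter.Tendsto (fun n => u (φ n) x) Filter.atTop (nhds (f x)) := by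
  have hp0 : 0 < p := by linarith
  set ω := volume.real (Metric.ball (0 : RN N) 1) with hω
  have hω0 : 0 < ω := volume_real_unit_ball_pos
  have hfin : IsFiniteMeasure (volume.restrict Ω) := ⟨by simpa using hb.measure_lt_top⟩
  set c := TopologicalSpace.denseSeq (RN N) with hc
  set δ : ℕ → ℝ := fun k => 1 / ((k : ℝ) + 1) with hδ
  have hδ0 : ∀ k, 0 < δ k := fun k => by simp only [hδ]; positivity
  choose i him hi using fun k => exists_measurable_index (N := N) (δ k) (hδ0 k)
  -- the integrals over all the balls converge simultaneously along a subsequence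
  set a : ℕ → ℕ × ℕ → ℝ := fun n jk => ∫ y in Metric.ball (c jk.1) (δ jk.2), u n y with ha
  have haD : ∀ n jk, |a n jk| ≤ D := fun n jk =>
    (abs_integral_le_integral_abs.trans (setIntegral_le_integral (hu n).abs
      (Filter.Eventually.of_forall fun x => abs_nonneg _))).trans (hD n)
  have hcpt : IsSeqCompact (Set.pi univ fun _ : ℕ × ℕ => Icc (-D) D) :=
    (isCompact_univ_pi fun _ => isCompact_Icc).isSeqCompact
  obtain ⟨l, -, φ, hφ, hlim⟩ := hcpt (x := a) fun n jk _ => abs_le.1 (haD n jk)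
  have hlim' : ∀ jk, Filter.Tendsto (fun n => a (φ n) jk) Filter.atTop (nhds (l jk)) :=
    fun jk => (tendsto_pi_nhds.1 hlim) jk
  have hlD : ∀ jk, |l jk| ≤ D := fun jk =>
    le_of_tendsto (hlim' jk).abs (Filter.Eventually.of_forall fun n => haD _ _)
  set β : ℕ → ℝ := fun k => δ k ^ (N : ℝ) * ω with hβ
  have hβ0 : ∀ k, 0 < β k := fun k => mul_pos (Real.rpow_pos_of_pos (hδ0 k) _) hω0
  set T : ℕ → ℕ → ℝ := fun k n => ∫ x in Ω, |a (φ n) (i k x, k) / β k - l (i k x, k) / β k| with hT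
  have hmeasa : ∀ k (b : ℕ × ℕ → ℝ), Measurable fun x => b (i k x, k) / β k := fun k b =>
    (measurable_from_nat (f := fun j => b (j, k) / β k)).comp (him k)
  have hTb : ∀ k n x, |a (φ n) (i k x, k) / β k - l (i k x, k) / β k| ≤ 2 * D / β k := by
    intro k n x
    rw [← sub_div, abs_div, abs_of_pos (hβ0 k)]
    refine div_le_div_of_nonneg_right ?_ (hβ0 k).le
    have := abs_sub (a (φ n) (i k x, k)) (l (i k x, k))
    linarith [haD (φ n) (i k x, k), hlD (i k x, k)]
  have hTint : ∀ k n, IntegrableOn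
      (fun x => |a (φ n) (i k x, k) / β k - l (i k x, k) / β k|) Ω := fun k n => by
    refine Integrable.mono' (integrable_const (2 * D / β k))
      ((hmeasa k _).sub (hmeasa k l)).abs.aestronglyMeasurable
      (Filter.Eventually.of_forall fun x => ?_)
    rw [Real.norm_of_nonneg (abs_nonneg _)]
    exact hTb k n x
  have hT0 : ∀ k, Filter.Tendsto (T k) Filter.atTop (nhds 0) := by
    intro k
    have := tendsto_integral_of_dominated_convergence (μ := volume.restrict Ω)
      (F := fun n x => |a (φ n) (i k x, k) / β k - l (i k x, k) / β k|) (f := fun _ => (0 : ℝ))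
      (fun _ => 2 * D / β k) (fun n => (hTint k n).1) (integrable_const _)
      (fun n => Filter.Eventually.of_forall fun x => by
        rw [Real.norm_of_nonneg (abs_nonneg _)]; exact hTb k n x)
      (Filter.Eventually.of_forall fun x => by
        have h1 := ((hlim' (i k x, k)).div_const (β k)).sub_const (l (i k x, k) / β k)
        rw [sub_self] at h1
        simpa using h1.abs)
    simpa using this
  have hδlim : Filter.Tendsto (fun k => δ k ^ (p * s)) Filter.atTop (nhds 0) := by
    have h1 : Filter.Tendsto δ Filter.atTop (nhds 0) := tendsto_one_div_add_atTop_nhds_zero_nat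
    have h2 := h1.rpow_const (p := p * s) (Or.inr (by positivity))
    rwa [Real.zero_rpow (by positivity)] at h2
  have hL1 : ∀ ε > 0, ∃ n₀, ∀ m ≥ n₀, ∀ n ≥ n₀, ∫ x in Ω, |u (φ m) x - u (φ n) x| < ε := by
    intro ε hε
    set η := ε / (8 * (volume.real Ω + 1)) with hη
    have hvol : 0 ≤ volume.real Ω := measureReal_nonneg
    have hη0 : 0 < η := by positivity
    have hηΩ : η * volume.real Ω ≤ ε / 8 := by
      rw [hη, div_mul_eq_mul_div, div_le_div_iff₀ (by positivity) (by norm_num)]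
      nlinarith
    have h1 : Filter.Tendsto (fun k => η ^ (1 - p) * (2 ^ ((N : ℝ) + p * s) * δ k ^ (p * s) / ω) *
        M) Filter.atTop (nhds 0) := by
      have := (((hδlim.const_mul (2 ^ ((N : ℝ) + p * s))).div_const ω).const_mul
        (η ^ (1 - p))).mul_const M
      simpa using this
    obtain ⟨k, hk⟩ := (h1.eventually_lt_const (show (0 : ℝ) < ε / 8 by positivity)).exists
    obtain ⟨n₀, hn₀⟩ := Filter.eventually_atTop.1
      ((hT0 k).eventually_lt_const (show (0 : ℝ) < ε / 8 by positivity))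
    refine ⟨n₀, fun m hm n hn => ?_⟩
    -- both terms of the sequence are close to the limit of the averages
    have key : ∀ n ≥ n₀, IntegrableOn (fun x => |u (φ n) x - l (i k x, k) / β k|) Ω ∧
        ∫ x in Ω, |u (φ n) x - l (i k x, k) / β k| < 3 * ε / 8 := by
      intro n hn
      obtain ⟨hi1, hi2⟩ := setIntegral_abs_sub_average_le hN hp hs hb (hu (φ n)) (hE (φ n))
        (hδ0 k) hη0 c (i k) (him k) (hi k)
      have hsum := hi1.add (hTint k n)
      have hpt : ∀ x, |u (φ n) x - l (i k x, k) / β k| ≤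
          |u (φ n) x - a (φ n) (i k x, k) / β k| +
          |a (φ n) (i k x, k) / β k - l (i k x, k) / β k| := fun x => abs_sub_le _ _ _
      have hint : IntegrableOn (fun x => |u (φ n) x - l (i k x, k) / β k|) Ω := by
        refine Integrable.mono' hsum
          ((hu (φ n)).1.sub (hmeasa k l).aestronglyMeasurable).norm.restrict
          (Filter.Eventually.of_forall fun x => ?_)
        rw [Real.norm_of_nonneg (abs_nonneg _)]
        exact hpt x
      refine ⟨hint, ?_⟩
      have h2 : η ^ (1 - p) * (2 ^ ((N : ℝ) + p * s) * δ k ^ (p * s) / ω) * energy s p (u (φ n)) ≤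
          η ^ (1 - p) * (2 ^ ((N : ℝ) + p * s) * δ k ^ (p * s) / ω) * M := by
        have := Real.rpow_nonneg (hδ0 k).le (p * s)
        exact mul_le_mul_of_nonneg_left (hM _) (by positivity)
      calc ∫ x in Ω, |u (φ n) x - l (i k x, k) / β k| ≤
            ∫ x in Ω, (|u (φ n) x - a (φ n) (i k x, k) / β k| +
              |a (φ n) (i k x, k) / β k - l (i k x, k) / β k|) :=
            setIntegral_mono hint hsum hpt
        _ = (∫ x in Ω, |u (φ n) x - a (φ n) (i k x, k) / β k|) + T k n :=
            integral_add hi1 (hTint k n)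
        _ < 3 * ε / 8 := by linarith [hn₀ n hn]
    obtain ⟨a1, a2⟩ := key m hm
    obtain ⟨b1, b2⟩ := key n hn
    calc ∫ x in Ω, |u (φ m) x - u (φ n) x| ≤
          ∫ x in Ω, (|u (φ m) x - l (i k x, k) / β k| + |u (φ n) x - l (i k x, k) / β k|) := by
          refine setIntegral_mono ((hu _).sub (hu _)).abs.integrableOn (a1.add b1) fun x => ?_
          have := abs_sub_le (u (φ m) x) (l (i k x, k) / β k) (u (φ n) x)
          rwa [abs_sub_comm (l (i k x, k) / β k)] at this
      _ = (∫ x in Ω, |u (φ m) x - l (i k x, k) / β k|) +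
          ∫ x in Ω, |u (φ n) x - l (i k x, k) / β k| := integral_add a1 b1
      _ < ε := by linarith
  -- completeness of `L^1(Ω)`
  have huΩ : ∀ n, Integrable (u (φ n)) (volume.restrict Ω) := fun n => (hu _).integrableOn
  have hcau : CauchySeq fun n => (huΩ n).toL1 (u (φ n)) := by
    rw [Metric.cauchySeq_iff]
    intro ε hε
    obtain ⟨n₀, hn₀⟩ := hL1 ε hε
    refine ⟨n₀, fun m hm n hn => ?_⟩
    rw [dist_eq_norm, ← Integrable.toL1_sub, L1.norm_of_fun_eq_integral_norm]
    exact hn₀ m hm n hn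
  obtain ⟨g, hg⟩ := cauchySeq_tendsto_of_complete hcau
  obtain ⟨ψ, hψ, hψlim⟩ := (tendstoInMeasure_of_tendsto_Lp hg).exists_seq_tendsto_ae
  refine ⟨φ ∘ ψ, g, hφ.comp hψ, ?_⟩
  have hall : ∀ᵐ x ∂(volume.restrict Ω), ∀ n, (huΩ n).toL1 (u (φ n)) x = u (φ n) x :=
    ae_all_iff.2 fun n => (huΩ n).coeFn_toL1
  filter_upwards [hψlim, hall] with x hx hx'
  simp only [hx'] at hx
  exact hx

/-! ### Carathéodory functions and their primitives -/

/-- A Carathéodory function agrees, for a.e. `x` and all `t`, with one that is measurable in `x`,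
continuous in `t` and satisfies the growth bound without exceptional points. -/
theorem exists_regular_reaction {f : RN N → ℝ → ℝ} {g : ℝ → ℝ} (hf : IsCaratheodory Ω f)
    (hg : ∀ t, 0 ≤ g t) (hfg : ∀ᵐ x ∂(volume.restrict Ω), ∀ t : ℝ, |f x t| ≤ g t) :
    ∃ f₀ : RN N → ℝ → ℝ, (∀ x, Continuous (f₀ x)) ∧ (∀ t, Measurable fun x => f₀ x t) ∧
      (∀ x t, |f₀ x t| ≤ g t) ∧ ∀ᵐ x ∂(volume.restrict Ω), ∀ t, f₀ x t = f x t := by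
  classical
  obtain ⟨hm, hcont⟩ := hf
  have hQ : ∀ᵐ x ∂(volume.restrict Ω), ∀ r : ℚ, f x r = (hm r).mk (fun x => f x r) x :=
    ae_all_iff.2 fun r => (hm r).ae_eq_mk
  obtain ⟨B, hB, hBm, hB0⟩ := exists_measurable_superset_of_null
    (ae_iff.1 (hcont.and (hQ.and hfg)))
  have hgood : ∀ x ∉ B, Continuous (f x) ∧ (∀ r : ℚ, f x r = (hm r).mk (fun x => f x r) x) ∧
      ∀ t : ℝ, |f x t| ≤ g t := fun x hx => by
    by_contra hc
    exact hx (hB hc)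
  have hc : ∀ x, Continuous fun t => if x ∈ B then 0 else f x t := fun x => by
    by_cases hx : x ∈ B
    · simp only [hx, if_true]; exact continuous_const
    · simp only [hx, if_false]; exact (hgood x hx).1
  refine ⟨fun x t => if x ∈ B then 0 else f x t, hc, fun t => ?_, fun x t => ?_, ?_⟩
  · have hrat : ∀ r : ℚ, Measurable fun x => if x ∈ B then 0 else f x r := fun r => by
      have h1 : Measurable fun x => if x ∈ B then 0 else (hm r).mk (fun x => f x r) x :=
        Measurable.ite hBm measurable_const (hm r).measurable_mk
      convert h1 using 2 with x
      by_cases hx : x ∈ B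
      · simp [hx]
      · simp only [hx, if_false]; exact (hgood x hx).2.1 r
    obtain ⟨r, hr⟩ := mem_closure_iff_seq_limit.1 (Rat.denseRange_cast (𝕜 := ℝ) t)
    choose r' hr' using hr.1
    refine measurable_of_tendsto_metrizable (fun n => hrat (r' n)) (tendsto_pi_nhds.2 fun x => ?_)
    have : Filter.Tendsto (fun n => ((r' n : ℚ) : ℝ)) Filter.atTop (nhds t) := by
      simpa only [hr'] using hr.2
    exact ((hc x).tendsto t).comp this
  · by_cases hx : x ∈ B
    · simpa [hx] using hg t
    · simpa [hx] using (hgood x hx).2.2 t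
  · have : ∀ᵐ x ∂(volume.restrict Ω), x ∉ B := measure_eq_zero_iff_ae_notMem.1 hB0
    filter_upwards [this] with x hx t
    simp [hx]

/-- The primitive `t ↦ ∫₀ᵗ g(x, τ) dτ` of a reaction. -/
noncomputable def primitive (g : RN N → ℝ → ℝ) (x : RN N) (t : ℝ) : ℝ := ∫ τ in (0 : ℝ)..t, g x τ

variable {g : RN N → ℝ → ℝ} {H : RN N → ℝ}

theorem hasDerivAt_primitive (hg : ∀ x, Continuous (g x)) (x : RN N) (t : ℝ) :
    HasDerivAt (primitive g x) (g x t) t :=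
  intervalIntegral.integral_hasDerivAt_right ((hg x).intervalIntegrable _ _)
    (hg x).stronglyMeasurable.stronglyMeasurableAtFilter (hg x).continuousAt

theorem primitive_sub (hg : ∀ x, Continuous (g x)) (x : RN N) (a b : ℝ) :
    primitive g x b - primitive g x a = ∫ τ in a..b, g x τ :=
  intervalIntegral.integral_interval_sub_left ((hg x).intervalIntegrable _ _)
    ((hg x).intervalIntegrable _ _)

theorem abs_primitive_le (hgH : ∀ x t, |g x t| ≤ H x) (x : RN N) (t : ℝ) :
    |primitive g x t| ≤ H x * |t| := by
  have := intervalIntegral.norm_integral_le_of_norm_le_const (a := 0) (b := t) (f := g x)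
    (C := H x) fun τ _ => hgH x τ
  simpa [primitive] using this

theorem measurable_uncurry_reaction (hg : ∀ x, Continuous (g x))
    (hm : ∀ t, Measurable fun x => g x t) : Measurable (Function.uncurry g) := by
  have h : Measurable (Function.uncurry fun t x => g x t) :=
    measurable_uncurry_of_continuous_of_measurable hg hm
  exact h.comp measurable_swap

theorem measurable_uncurry_primitive (hg : ∀ x, Continuous (g x))
    (hm : ∀ t, Measurable fun x => g x t) : Measurable (Function.uncurry (primitive g)) := by
  refine measurable_uncurry_reaction
    (fun x => continuous_iff_continuousAt.2 fun t => (hasDerivAt_primitive hg x t).continuousAt)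
    fun t => ?_
  have h := (measurable_uncurry_reaction hg hm).stronglyMeasurable
  unfold primitive intervalIntegral
  exact (h.integral_prod_right.sub h.integral_prod_right).measurable

theorem aestronglyMeasurable_comp {μ : Measure (RN N)} (hg : Measurable (Function.uncurry g))
    (hu : AEStronglyMeasurable u μ) : AEStronglyMeasurable (fun x => g x (u x)) μ :=
  (hg.comp_aemeasurable (aemeasurable_id.prodMk hu.aemeasurable)).aestronglyMeasurable

/-! ### The variational problem -/

/-- The functional `u ↦ (1/p) [u]^p - ∫_Ω G(x, u) dx`, where `G` is the primitive of `g`. -/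
noncomputable def functional (s p : ℝ) (Ω : Set (RN N)) (g : RN N → ℝ → ℝ) (u : RN N → ℝ) : ℝ :=
  energy s p u / p - ∫ x in Ω, primitive g x (u x)

/-- A reaction that is continuous in the second variable, measurable in the first one, and bounded
by a weight that is integrable against every function of `W^{s,p}_0(Ω)`. -/
structure IsDominatedReaction (s p : ℝ) (Ω : Set (RN N)) (g : RN N → ℝ → ℝ) (H : RN N → ℝ) :
    Prop where
  continuous : ∀ x, Continuous (g x)
  measurable : ∀ t, Measurable fun x => g x t
  bound : ∀ x t, |g x t| ≤ H x
  integrable : ∀ v, MemW0 s p Ω v → IntegrableOn (fun x => H x * |v x|) Ω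

theorem IsDominatedReaction.integrableOn_primitive (hg : IsDominatedReaction s p Ω g H)
    (hu : MemW0 s p Ω u) : IntegrableOn (fun x => primitive g x (u x)) Ω :=
  (hg.integrable u hu).mono' (aestronglyMeasurable_comp
    (measurable_uncurry_primitive hg.continuous hg.measurable) hu.aestronglyMeasurable).restrict
    (Filter.Eventually.of_forall fun x => abs_primitive_le hg.bound x (u x))

theorem IsDominatedReaction.integrableOn_mul (hg : IsDominatedReaction s p Ω g H)
    (hu : AEStronglyMeasurable u) (hv : MemW0 s p Ω v) :
    IntegrableOn (fun x => g x (u x) * v x) Ω := by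
  refine (hg.integrable v hv).mono' ((aestronglyMeasurable_comp
    (measurable_uncurry_reaction hg.continuous hg.measurable) hu).mul
      hv.aestronglyMeasurable).restrict (Filter.Eventually.of_forall fun x => ?_)
  rw [Real.norm_eq_abs, abs_mul]
  exact mul_le_mul_of_nonneg_right (hg.bound _ _) (abs_nonneg _)

theorem hasDerivAt_energy (hp : 2 ≤ p) (hu : MemW0 s p Ω u) (hv : MemW0 s p Ω v) :
    HasDerivAt (fun t : ℝ => energy s p fun x => u x + t * v x) (p * pairing s p u v) 0 := by
  have hp0 : 0 < p := by linarith
  have hmem : ∀ t : ℝ, MemW0 s p Ω fun x => u x + t * v x := fun t => hu.add hp0 (hv.const_mul hp0 t)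
  have hEu := memW_univ_integrable_energyDensity hu.1
  have hEv := memW_univ_integrable_energyDensity hv.1
  have key := hasDerivAt_integral_of_dominated_loc_of_deriv_le (μ := volume) (x₀ := (0 : ℝ))
    (s := Metric.ball (0 : ℝ) 1)
    (F := fun t z => energyDensity s p (fun x => u x + t * v x) z)
    (F' := fun t z => p * pairingDensity s p (fun x => u x + t * v x) v z)
    (bound := fun z => p * (2 ^ p * (energyDensity s p u z + energyDensity s p v z) +
      energyDensity s p v z))
    (Metric.ball_mem_nhds 0 one_pos)
    (Filter.Eventually.of_forall fun t =>
      aestronglyMeasurable_energyDensity (hmem t).aestronglyMeasurable)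
    (memW_univ_integrable_energyDensity (hmem 0).1)
    ((aestronglyMeasurable_pairingDensity (hmem 0).aestronglyMeasurable
      hv.aestronglyMeasurable).const_mul p)
    (Filter.Eventually.of_forall fun z t ht => by
      rw [Real.norm_eq_abs, abs_mul, abs_of_pos hp0]
      refine mul_le_mul_of_nonneg_left ((abs_pairingDensity_le hp z).trans ?_) hp0.le
      gcongr
      unfold energyDensity
      rw [← add_div, ← mul_div_assoc]
      gcongr
      refine le_trans ?_ (add_rpow_le_two_rpow_mul (abs_nonneg _) (abs_nonneg _) hp0.le)
      refine Real.rpow_le_rpow (abs_nonneg _) ?_ hp0.le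
      have ht' : |t| ≤ 1 := by
        have := Metric.mem_ball.1 ht
        rw [dist_zero_right, Real.norm_eq_abs] at this
        exact this.le
      calc |u z.1 + t * v z.1 - (u z.2 + t * v z.2)|
          = |(u z.1 - u z.2) + t * (v z.1 - v z.2)| := by congr 1; ring
        _ ≤ |u z.1 - u z.2| + |t| * |v z.1 - v z.2| := by
          rw [← abs_mul]; exact abs_add_le _ _
        _ ≤ |u z.1 - u z.2| + 1 * |v z.1 - v z.2| := by gcongr
        _ = _ := by rw [one_mul])
    ((((hEu.add hEv).const_mul _).add hEv).const_mul p)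
    (Filter.Eventually.of_forall fun z t _ => by
      have h1 : HasDerivAt (fun t : ℝ => u z.1 + t * v z.1 - (u z.2 + t * v z.2))
          (v z.1 - v z.2) t := by
        have h2 := ((hasDerivAt_id t).mul_const (v z.1 - v z.2)).const_add (u z.1 - u z.2)
        rw [one_mul] at h2
        refine h2.congr_of_eventuallyEq (Filter.Eventually.of_forall fun t => ?_)
        simp only [id]
        ring
      have h3 := ((hasDerivAt_abs_rpow (u z.1 + t * v z.1 - (u z.2 + t * v z.2))
        (show 1 < p by linarith)).comp t h1).div_const (‖z.1 - z.2‖ ^ ((N : ℝ) + p * s))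
      refine h3.congr_deriv ?_
      simp only [pairingDensity]
      ring)
  have h := key.2
  simp only [zero_mul, add_zero] at h
  rw [integral_const_mul] at h
  exact h

theorem IsDominatedReaction.hasDerivAt_integral_primitive (hp : 2 ≤ p)
    (hg : IsDominatedReaction s p Ω g H) (hu : MemW0 s p Ω u) (hv : MemW0 s p Ω v) :
    HasDerivAt (fun t : ℝ => ∫ x in Ω, primitive g x (u x + t * v x))
      (∫ x in Ω, g x (u x) * v x) 0 := by
  have hp0 : 0 < p := by linarith
  have hmem : ∀ t : ℝ, MemW0 s p Ω fun x => u x + t * v x := fun t => hu.add hp0 (hv.const_mul hp0 t)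
  have key := hasDerivAt_integral_of_dominated_loc_of_deriv_le (μ := volume.restrict Ω)
    (x₀ := (0 : ℝ)) (s := univ)
    (F := fun t x => primitive g x (u x + t * v x))
    (F' := fun t x => g x (u x + t * v x) * v x)
    (bound := fun x => H x * |v x|) Filter.univ_mem
    (Filter.Eventually.of_forall fun t => (hg.integrableOn_primitive (hmem t)).1)
    (hg.integrableOn_primitive (hmem 0))
    (hg.integrableOn_mul (hmem 0).aestronglyMeasurable hv).1
    (Filter.Eventually.of_forall fun x t _ => by
      rw [Real.norm_eq_abs, abs_mul]
      exact mul_le_mul_of_nonneg_right (hg.bound _ _) (abs_nonneg _))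
    (hg.integrable v hv)
    (Filter.Eventually.of_forall fun x t _ => by
      have h1 : HasDerivAt (fun t : ℝ => u x + t * v x) (v x) t := by
        have h2 := ((hasDerivAt_id t).mul_const (v x)).const_add (u x)
        rwa [one_mul] at h2
      exact (hasDerivAt_primitive hg.continuous x (u x + t * v x)).comp t h1)
  simpa only [zero_mul, add_zero] using key.2

/-- The Euler-Lagrange equation. -/
theorem IsDominatedReaction.pairing_eq_of_minimizer (hp : 2 ≤ p)
    (hg : IsDominatedReaction s p Ω g H) (hu : MemW0 s p Ω u)
    (hmin : ∀ v, MemW0 s p Ω v → functional s p Ω g u ≤ functional s p Ω g v)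
    (hv : MemW0 s p Ω v) : pairing s p u v = ∫ x in Ω, g x (u x) * v x := by
  have hp0 : 0 < p := by linarith
  have h1 := ((hasDerivAt_energy hp hu hv).div_const p).sub
    (hg.hasDerivAt_integral_primitive hp hu hv)
  have h2 : IsLocalMin (fun t : ℝ => functional s p Ω g fun x => u x + t * v x) 0 :=
    Filter.Eventually.of_forall fun t => by
      simpa using hmin _ (hu.add hp0 (hv.const_mul hp0 t))
  have h3 := h2.hasDerivAt_eq_zero h1
  rw [mul_div_cancel_left₀ _ hp0.ne'] at h3
  linarith

/-- Truncation from above at a supersolution does not increase the functional. Here `k` is the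
right-hand side of the inequality for `w`. -/
theorem IsDominatedReaction.functional_min_le (hp : 2 ≤ p) (hs : 0 < s) (hΩ : IsOpen Ω)
    (hb : Bornology.IsBounded Ω) (hg : IsDominatedReaction s p Ω g H) (hu : MemW0 s p Ω u)
    (hw : MemWTilde s p Ω w) (hw0 : ∀ᵐ x ∂(volume.restrict Ωᶜ), 0 ≤ w x) {k : RN N → ℝ}
    (hk : ∀ v, MemW0 s p Ω v → IntegrableOn (fun x => k x * v x) Ω)
    (hkw : ∀ v, MemW0 s p Ω v → (∀ᵐ x, 0 ≤ v x) → ∫ x in Ω, k x * v x ≤ pairing s p w v)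
    (hgk : ∀ᵐ x ∂(volume.restrict Ω), ∀ t, w x ≤ t → g x t ≤ k x) :
    functional s p Ω g (fun x => min (u x) (w x)) ≤ functional s p Ω g u := by
  have hp0 : 0 < p := by linarith
  have hm := hu.inf hp hs hΩ hb hw hw0
  have hv := hu.sub hp0 hm
  have h1 := energy_min_le hp hs hΩ hb hu hw hw0
  have h2 := hkw _ hv (Filter.Eventually.of_forall fun x => sub_nonneg.2 (min_le_left _ _))
  have h3 : (∫ x in Ω, primitive g x (u x)) - ∫ x in Ω, primitive g x (min (u x) (w x)) ≤
      ∫ x in Ω, k x * (u x - min (u x) (w x)) := by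
    rw [← integral_sub (hg.integrableOn_primitive hu) (hg.integrableOn_primitive hm)]
    refine setIntegral_mono_ae_restrict
      ((hg.integrableOn_primitive hu).sub (hg.integrableOn_primitive hm)) (hk _ hv) ?_
    filter_upwards [hgk] with x hx
    rw [primitive_sub hg.continuous]
    rcases le_total (u x) (w x) with h | h
    · simp [min_eq_left h]
    · rw [min_eq_right h]
      calc ∫ τ in w x..u x, g x τ ≤ ∫ _ in w x..u x, k x :=
            intervalIntegral.integral_mono_on h ((hg.continuous x).intervalIntegrable _ _)
              intervalIntegrable_const fun t ht => hx t ht.1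
        _ = k x * (u x - w x) := by simp [mul_comm]
  unfold functional
  have h4 : energy s p (fun x => min (u x) (w x)) / p +
      pairing s p w (fun x => u x - min (u x) (w x)) ≤ energy s p u / p := by
    rw [le_div_iff₀ hp0, add_mul, div_mul_cancel₀ _ hp0.ne']
    linarith
  linarith

/-- Truncation from below at a subsolution does not increase the functional. -/
theorem IsDominatedReaction.functional_max_le (hp : 2 ≤ p) (hs : 0 < s) (hΩ : IsOpen Ω)
    (hb : Bornology.IsBounded Ω) (hg : IsDominatedReaction s p Ω g H) (hu : MemW0 s p Ω u)
    (hw : MemWTilde s p Ω w) (hw0 : ∀ᵐ x ∂(volume.restrict Ωᶜ), w x ≤ 0) {k : RN N → ℝ}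
    (hk : ∀ v, MemW0 s p Ω v → IntegrableOn (fun x => k x * v x) Ω)
    (hkw : ∀ v, MemW0 s p Ω v → (∀ᵐ x, 0 ≤ v x) → pairing s p w v ≤ ∫ x in Ω, k x * v x)
    (hgk : ∀ᵐ x ∂(volume.restrict Ω), ∀ t, t ≤ w x → k x ≤ g x t) :
    functional s p Ω g (fun x => max (u x) (w x)) ≤ functional s p Ω g u := by
  have hp0 : 0 < p := by linarith
  have hm := hu.sup hp hs hΩ hb hw hw0
  have hv := hm.sub hp0 hu
  have h1 := energy_max_le hp hs hΩ hb hu hw hw0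
  have h2 := hkw _ hv (Filter.Eventually.of_forall fun x => sub_nonneg.2 (le_max_left _ _))
  have h3 : ∫ x in Ω, k x * (max (u x) (w x) - u x) ≤
      (∫ x in Ω, primitive g x (max (u x) (w x))) - ∫ x in Ω, primitive g x (u x) := by
    rw [← integral_sub (hg.integrableOn_primitive hm) (hg.integrableOn_primitive hu)]
    refine setIntegral_mono_ae_restrict (hk _ hv)
      ((hg.integrableOn_primitive hm).sub (hg.integrableOn_primitive hu)) ?_
    filter_upwards [hgk] with x hx
    rw [primitive_sub hg.continuous]
    rcases le_total (w x) (u x) with h | h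
    · simp [max_eq_left h]
    · rw [max_eq_right h]
      calc k x * (w x - u x) = ∫ _ in u x..w x, k x := by simp [mul_comm]
        _ ≤ ∫ τ in u x..w x, g x τ :=
            intervalIntegral.integral_mono_on h intervalIntegrable_const
              ((hg.continuous x).intervalIntegrable _ _) fun t ht => hx t ht.2
  unfold functional
  have h4 : energy s p (fun x => max (u x) (w x)) / p ≤ energy s p u / p +
      pairing s p w (fun x => max (u x) (w x) - u x) := by
    rw [div_le_iff₀ hp0, add_mul, div_mul_cancel₀ _ hp0.ne']
    linarith
  linarith

/-- The order interval `[a, b]` in `W^{s,p}_0(Ω)`. -/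
def orderInterval (s p : ℝ) (Ω : Set (RN N)) (a b : RN N → ℝ) : Set (RN N → ℝ) :=
  {u | MemW0 s p Ω u ∧ ∀ᵐ x ∂(volume.restrict Ω), a x ≤ u x ∧ u x ≤ b x}

theorem MemW0.ofReal_energy (hu : MemW0 s p Ω u) :
    ENNReal.ofReal (energy s p u) = ∫⁻ z, ENNReal.ofReal (energyDensity s p u z) :=
  ofReal_integral_eq_lintegral_ofReal (memW_univ_integrable_energyDensity hu.1)
    (Filter.Eventually.of_forall energyDensity_nonneg)

theorem gagliardo_univ :
    gagliardo s p univ u = ∫⁻ z, ENNReal.ofReal (energyDensity s p u z) := by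
  unfold gagliardo
  rw [Measure.restrict_univ]
  rfl

theorem MemW0.energy_eq_toReal (hu : MemW0 s p Ω u) :
    energy s p u = (gagliardo s p univ u).toReal := by
  rw [gagliardo_univ, ← hu.ofReal_energy, ENNReal.toReal_ofReal]
  exact integral_nonneg energyDensity_nonneg

/-- Lower semicontinuity of the seminorm under a.e. convergence. -/
theorem gagliardo_le_of_tendsto {un : ℕ → RN N → ℝ} (hp : 0 < p) (hun : ∀ n, MemW0 s p Ω (un n))
    (hlim : ∀ᵐ x, Filter.Tendsto (fun n => un n x) Filter.atTop (nhds (u x))) {L : ℝ}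
    (hL : Filter.Tendsto (fun n => energy s p (un n)) Filter.atTop (nhds L)) :
    gagliardo s p univ u ≤ ENNReal.ofReal L := by
  have h1 : Filter.Tendsto (fun n => ∫⁻ z, ENNReal.ofReal (energyDensity s p (un n) z))
      Filter.atTop (nhds (ENNReal.ofReal L)) :=
    ((ENNReal.continuous_ofReal.tendsto L).comp hL).congr fun n => (hun n).ofReal_energy
  rw [gagliardo_univ, ← h1.liminf_eq]
  refine le_trans (lintegral_mono_ae ?_) (lintegral_liminf_le' fun n =>
    (aestronglyMeasurable_energyDensity
      (hun n).aestronglyMeasurable).aemeasurable.ennreal_ofReal)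
  filter_upwards [ae_prod_of_ae hlim] with z hz
  have h2 : Filter.Tendsto (fun n => energyDensity s p (un n) z) Filter.atTop
      (nhds (energyDensity s p u z)) :=
    (((hz.1.sub hz.2).abs.rpow_const (Or.inr hp.le)).div_const _)
  exact ((ENNReal.continuous_ofReal.tendsto _).comp h2).liminf_eq.ge

/-- The functional attains its minimum on an order interval. -/
theorem IsDominatedReaction.exists_minimizer (hN : 0 < N) (hp : 2 ≤ p) (hs : 0 < s) (hΩ : IsOpen Ω)
    (hb : Bornology.IsBounded Ω) (hg : IsDominatedReaction s p Ω g H) {a b h : RN N → ℝ}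
    (hne : (orderInterval s p Ω a b).Nonempty)
    (hh : MemLp h (ENNReal.ofReal p) (volume.restrict Ω))
    (hHh : IntegrableOn (fun x => H x * |h x|) Ω)
    (hbd : ∀ u ∈ orderInterval s p Ω a b, ∀ᵐ x ∂(volume.restrict Ω), |u x| ≤ |h x|) :
    ∃ u ∈ orderInterval s p Ω a b, ∀ v ∈ orderInterval s p Ω a b,
      functional s p Ω g u ≤ functional s p Ω g v := by
  have hp0 : 0 < p := by linarith
  have hfin : IsFiniteMeasure (volume.restrict Ω) := ⟨by simpa using hb.measure_lt_top⟩
  have hH0 : ∀ x, 0 ≤ H x := fun x => (abs_nonneg _).trans (hg.bound x 0)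
  have hh1 : IntegrableOn (fun x => |h x|) Ω := (hh.integrable (by simp; linarith)).abs
  set C := ∫ x in Ω, H x * |h x| with hC
  set K := orderInterval s p Ω a b with hK
  have hprim : ∀ v ∈ K, ∀ᵐ x ∂(volume.restrict Ω), ‖primitive g x (v x)‖ ≤ H x * |h x| := by
    intro v hv
    filter_upwards [hbd v hv] with x hx
    exact (abs_primitive_le hg.bound x (v x)).trans (mul_le_mul_of_nonneg_left hx (hH0 x))
  have hprimC : ∀ v ∈ K, |∫ x in Ω, primitive g x (v x)| ≤ C := fun v hv =>
    norm_integral_le_of_norm_le hHh (hprim v hv)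
  have hE0 : ∀ v : RN N → ℝ, 0 ≤ energy s p v := fun v => integral_nonneg energyDensity_nonneg
  have hbelow : BddBelow (functional s p Ω g '' K) := by
    refine ⟨-C, ?_⟩
    rintro _ ⟨v, hv, rfl⟩
    have h1 := (abs_le.1 (hprimC v hv)).2
    have h2 := div_nonneg (hE0 v) hp0.le
    unfold functional
    linarith
  obtain ⟨J, hJanti, hJlim, hJmem⟩ := exists_seq_tendsto_sInf (hne.image _) hbelow
  set I := sInf (functional s p Ω g '' K) with hI
  choose un hunK hunJ using hJmem
  have hEeq : ∀ n, energy s p (un n) = p * (J n + ∫ x in Ω, primitive g x (un n x)) := by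
    intro n
    rw [← hunJ n]
    unfold functional
    field_simp
    ring
  have hae0 : ∀ v ∈ K, ∀ᵐ x, x ∉ Ω → v x = 0 := fun v hv => hv.1.ae_eq_zero hΩ
  have hunint : ∀ v ∈ K, IntegrableOn v Ω := fun v hv => by
    refine hh1.mono' hv.1.aestronglyMeasurable.restrict ?_
    exact hbd v hv
  have hun1 : ∀ n, Integrable (un n) := fun n =>
    integrable_of_ae_eq_zero_compl hΩ.measurableSet (hae0 _ (hunK n)) (hunint _ (hunK n))
  have hunD : ∀ n, ∫ x, |un n x| ≤ ∫ x in Ω, |h x| := by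
    intro n
    have e : ∫ x, |un n x| = ∫ x in Ω, |un n x| := by
      symm
      apply setIntegral_eq_integral_of_ae_compl_eq_zero
      filter_upwards [hae0 _ (hunK n)] with x hx hxΩ
      simp [hx hxΩ]
    rw [e]
    exact setIntegral_mono_ae_restrict (hun1 n).abs.integrableOn hh1 (hbd _ (hunK n))
  have hunM : ∀ n, energy s p (un n) ≤ p * (J 0 + C) := by
    intro n
    rw [hEeq]
    have h1 := (abs_le.1 (hprimC _ (hunK n))).2
    have h2 := hJanti (Nat.zero_le n)
    gcongr
  obtain ⟨φ, f, hφ, hf⟩ := exists_subseq_tendsto_ae hN (by linarith) hs hb un hun1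
    (fun n => memW_univ_integrable_energyDensity (hunK n).1.1) hunD hunM
  classical
  set u : RN N → ℝ := Ω.indicator f with hu
  have huΩ : ∀ x ∈ Ω, u x = f x := fun x hx => indicator_of_mem hx f
  have hlim : ∀ᵐ x, Filter.Tendsto (fun n => un (φ n) x) Filter.atTop (nhds (u x)) := by
    rw [ae_restrict_iff' hΩ.measurableSet] at hf
    filter_upwards [hf, ae_all_iff.2 fun n => hae0 _ (hunK (φ n))] with x h1 h2
    by_cases hx : x ∈ Ω
    · rw [huΩ x hx]; exact h1 hx
    · simp only [h2 _ hx, hu, indicator_of_notMem hx]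
      exact tendsto_const_nhds
  have hum : AEStronglyMeasurable u :=
    aestronglyMeasurable_of_tendsto_ae Filter.atTop
      (fun n => (hunK (φ n)).1.aestronglyMeasurable) hlim
  have hlimΩ := ae_restrict_of_ae (s := Ω) hlim
  have huab : ∀ᵐ x ∂(volume.restrict Ω), a x ≤ u x ∧ u x ≤ b x := by
    filter_upwards [hlimΩ, ae_all_iff.2 fun n => (hunK (φ n)).2] with x h1 h2
    exact ⟨ge_of_tendsto' h1 fun n => (h2 n).1, le_of_tendsto' h1 fun n => (h2 n).2⟩
  have huh : ∀ᵐ x ∂(volume.restrict Ω), |u x| ≤ |h x| := by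
    filter_upwards [hlimΩ, ae_all_iff.2 fun n => hbd _ (hunK (φ n))] with x h1 h2
    exact le_of_tendsto' h1.abs h2
  have huLp : MemLp u (ENNReal.ofReal p) := by
    have h1 : MemLp u (ENNReal.ofReal p) (volume.restrict Ω) := hh.mono hum.restrict huh
    rw [← memLp_indicator_iff_restrict hΩ.measurableSet] at h1
    rwa [hu, indicator_indicator, inter_self] at h1
  have hprimlim : Filter.Tendsto (fun n => ∫ x in Ω, primitive g x (un (φ n) x)) Filter.atTop
      (nhds (∫ x in Ω, primitive g x (u x))) := by
    refine tendsto_integral_of_dominated_convergence _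
      (fun n => (hg.integrableOn_primitive (hunK (φ n)).1).1) hHh
      (fun n => hprim _ (hunK (φ n))) ?_
    filter_upwards [hlimΩ] with x hx
    exact ((hasDerivAt_primitive hg.continuous x (u x)).continuousAt.tendsto).comp hx
  have hElim : Filter.Tendsto (fun n => energy s p (un (φ n))) Filter.atTop
      (nhds (p * (I + ∫ x in Ω, primitive g x (u x)))) := by
    simp only [hEeq]
    exact ((hJlim.comp hφ.tendsto_atTop).add hprimlim).const_mul p
  have hgag := gagliardo_le_of_tendsto hp0 (fun n => (hunK (φ n)).1) hlim hElim
  have huW : MemW0 s p Ω u := by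
    refine ⟨⟨by rwa [Measure.restrict_univ], hgag.trans_lt ENNReal.ofReal_lt_top⟩, ?_⟩
    rw [ae_restrict_iff' hΩ.measurableSet.compl]
    exact Filter.Eventually.of_forall fun x hx => indicator_of_notMem hx f
  refine ⟨u, ⟨huW, huab⟩, fun v hv => ?_⟩
  have hIv : I ≤ functional s p Ω g v := csInf_le hbelow (mem_image_of_mem _ hv)
  refine le_trans ?_ hIv
  have hL0 : 0 ≤ p * (I + ∫ x in Ω, primitive g x (u x)) :=
    ge_of_tendsto' hElim fun n => hE0 _
  have hEu : energy s p u ≤ p * (I + ∫ x in Ω, primitive g x (u x)) := by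
    rw [huW.energy_eq_toReal]
    exact ENNReal.toReal_le_of_le_ofReal hL0 hgag
  have h1 : energy s p u / p ≤ I + ∫ x in Ω, primitive g x (u x) := by
    rwa [div_le_iff₀' hp0]
  unfold functional
  linarith

/-! ### Solutions below two given solutions -/

/-- Products with the growth weight `c (1 + |h|^(q-1))` are integrable for functions in `L^q`. -/
theorem integrableOn_growth_mul {h : RN N → ℝ} (hb : Bornology.IsBounded Ω) {q c : ℝ} (hq : 1 ≤ q)
    (hc : 0 ≤ c) (hm : AEStronglyMeasurable h (volume.restrict Ω))
    (hvm : AEStronglyMeasurable v (volume.restrict Ω))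
    (hh : IntegrableOn (fun x => |h x| ^ q) Ω) (hv : IntegrableOn (fun x => |v x| ^ q) Ω) :
    IntegrableOn (fun x => c * (1 + |h x| ^ (q - 1)) * |v x|) Ω := by
  have hfin : IsFiniteMeasure (volume.restrict Ω) := ⟨by simpa using hb.measure_lt_top⟩
  have hdom : IntegrableOn (fun x => c * (1 + |v x| ^ q + (|h x| ^ q + |v x| ^ q))) Ω :=
    (((integrable_const (1 : ℝ)).add hv).add (hh.add hv)).const_mul c
  refine hdom.mono' ?_ (Filter.Eventually.of_forall fun x => ?_)
  · exact ((((measurable_id.abs.pow_const (q - 1)).comp_aemeasurable hm.aemeasurable).const_add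
      1).const_mul c |>.mul hvm.aemeasurable.abs).aestronglyMeasurable
  · rw [Real.norm_of_nonneg (by positivity), mul_assoc, add_mul, one_mul]
    have h1 : |v x| ≤ 1 + |v x| ^ q := by
      simpa using rpow_le_one_add_rpow (abs_nonneg (v x)) zero_le_one hq
    have h2 := rpow_sub_one_mul_le (abs_nonneg (h x)) (abs_nonneg (v x)) hq
    gcongr

theorem abs_min_max_le {a b h : ℝ} (ha : |a| ≤ h) (hb : |b| ≤ h) (t : ℝ) :
    |min (max t a) b| ≤ h := by
  rw [abs_le] at *
  exact ⟨le_min (ha.1.trans (le_max_right _ _)) hb.1, (min_le_right _ _).trans hb.2⟩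

/-- The reaction frozen below `a` and above `b₁`, resp. `b₂`, the smaller of the two values being
taken. It agrees with the original one between `a` and `min b₁ b₂`, and for `t ≥ bᵢ` it is at most
the value of the original one at `bᵢ`. -/
noncomputable def truncatedReaction (f : RN N → ℝ → ℝ) (a b₁ b₂ : RN N → ℝ) (x : RN N) (t : ℝ) :
    ℝ :=
  min (f x (min (max t (a x)) (b₁ x))) (f x (min (max t (a x)) (b₂ x)))

/-- Two solutions above a subsolution have a common lower bound among the solutions above that
subsolution. -/
theorem exists_solution_le (hN : 0 < N) (hp : 2 ≤ p) (hs : 0 < s) (hps : p * s < N)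
    (hΩ : IsOpen Ω) (hb : Bornology.IsBounded Ω) {f : RN N → ℝ → ℝ} (hf : H0 s p Ω f)
    {uSub u₁ u₂ : RN N → ℝ} (hsub : IsSubsolution s p Ω f uSub) (hu₁ : IsSolution s p Ω f u₁)
    (hu₂ : IsSolution s p Ω f u₂) (hle₁ : uSub ≤ᵐ[volume.restrict Ω] u₁)
    (hle₂ : uSub ≤ᵐ[volume.restrict Ω] u₂) :
    ∃ u, IsSolution s p Ω f u ∧ uSub ≤ᵐ[volume.restrict Ω] u ∧ u ≤ᵐ[volume] u₁ ∧
      u ≤ᵐ[volume] u₂ := by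
  have hp0 : 0 < p := by linarith
  have hp1 : 1 ≤ p := by linarith
  obtain ⟨hcar, c₀, q, hc₀, hpq, hq, hgrowth⟩ := hf
  have hq1 : 1 ≤ q := by linarith
  have hq0 : 0 ≤ q - 1 := by linarith
  obtain ⟨f₀, hf₀c, hf₀m, hf₀b, hf₀f⟩ := exists_regular_reaction
    (g := fun t => c₀ * (1 + |t| ^ (q - 1))) hcar (fun t => by positivity) hgrowth
  -- measurable representatives make the truncated reaction measurable in `x`
  have hma := hsub.1.aestronglyMeasurable
  have hm₁ := hu₁.1.aestronglyMeasurable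
  have hm₂ := hu₂.1.aestronglyMeasurable
  set a := hma.mk uSub with ha
  set b₁ := hm₁.mk u₁ with hb₁
  set b₂ := hm₂.mk u₂ with hb₂
  have hmeasa : Measurable a := hma.stronglyMeasurable_mk.measurable
  have hmeas₁ : Measurable b₁ := hm₁.stronglyMeasurable_mk.measurable
  have hmeas₂ : Measurable b₂ := hm₂.stronglyMeasurable_mk.measurable
  have hea : ∀ᵐ x ∂(volume.restrict Ω), uSub x = a x := ae_restrict_of_ae hma.ae_eq_mk
  have he₁ : ∀ᵐ x ∂(volume.restrict Ω), u₁ x = b₁ x := ae_restrict_of_ae hm₁.ae_eq_mk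
  have he₂ : ∀ᵐ x ∂(volume.restrict Ω), u₂ x = b₂ x := ae_restrict_of_ae hm₂.ae_eq_mk
  -- the weight of the reaction has to be defined everywhere, so it is built from representatives
  set h : RN N → ℝ := fun x => |uSub x| + |u₁ x| + |u₂ x| with hh
  set h' : RN N → ℝ := fun x => |a x| + |b₁ x| + |b₂ x| with hh'
  have heh : ∀ᵐ x ∂(volume.restrict Ω), h x = h' x := by
    filter_upwards [hea, he₁, he₂] with x h1 h2 h3
    simp only [hh, hh', h1, h2, h3]
  have hmeash : Measurable h' := (hmeasa.abs.add hmeas₁.abs).add hmeas₂.abs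
  have hh'0 : ∀ x, 0 ≤ h' x := fun x => by positivity
  have hmemLp : ∀ v, MemWTilde s p Ω v → MemLp v (ENNReal.ofReal p) (volume.restrict Ω) := by
    rintro v ⟨-, ⟨U, -, hΩU, hvU⟩, -⟩
    exact (hvU.mono (subset_closure.trans hΩU)).1
  have hLq : ∀ v, MemWTilde s p Ω v → IntegrableOn (fun x => |v x| ^ q) Ω := fun v hv =>
    hv.integrableOn_rpow hN hp1 hs hps hΩ hb (by linarith) hq
  have hW₁ := hu₁.1.memWTilde hp1 hs
  have hW₂ := hu₂.1.memWTilde hp1 hs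
  have hhLp : MemLp h' (ENNReal.ofReal p) (volume.restrict Ω) :=
    (((hmemLp _ hsub.1).norm.add (hmemLp _ hW₁).norm).add (hmemLp _ hW₂).norm).ae_eq heh
  have hhLq : IntegrableOn (fun x => |h' x| ^ q) Ω := by
    have hdom : IntegrableOn (fun x => 2 ^ q * (2 ^ q * (|uSub x| ^ q + |u₁ x| ^ q) +
        |u₂ x| ^ q)) Ω :=
      ((((hLq _ hsub.1).add (hLq _ hW₁)).const_mul (2 ^ q)).add (hLq _ hW₂)).const_mul (2 ^ q)
    refine hdom.mono' (hmeash.abs.pow_const q).aestronglyMeasurable ?_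
    filter_upwards [heh] with x hx
    rw [Real.norm_of_nonneg (by positivity), ← hx, abs_of_nonneg (by positivity)]
    refine (add_rpow_le_two_rpow_mul (by positivity) (by positivity) (by linarith)).trans ?_
    gcongr
    exact add_rpow_le_two_rpow_mul (by positivity) (by positivity) (by linarith)
  set H : RN N → ℝ := fun x => c₀ * (1 + |h' x| ^ (q - 1)) with hH
  have hHv : ∀ v, MemW0 s p Ω v → IntegrableOn (fun x => H x * |v x|) Ω := fun v hv =>
    integrableOn_growth_mul hb hq1 hc₀.le hmeash.aestronglyMeasurable
      hv.aestronglyMeasurable.restrict hhLq (hLq _ (hv.memWTilde hp1 hs))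
  have hHh : IntegrableOn (fun x => H x * |h' x|) Ω :=
    integrableOn_growth_mul hb hq1 hc₀.le hmeash.aestronglyMeasurable
      hmeash.aestronglyMeasurable hhLq hhLq
  have hbound : ∀ x t, |t| ≤ h' x → |f₀ x t| ≤ H x := fun x t ht => by
    refine (hf₀b x t).trans ?_
    simp only [hH]
    rw [abs_of_nonneg (hh'0 x)]
    gcongr
  have haH : ∀ x, |a x| ≤ h' x := fun x => by
    simp only [hh']; linarith [abs_nonneg (b₁ x), abs_nonneg (b₂ x)]
  have hbH₁ : ∀ x, |b₁ x| ≤ h' x := fun x => by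
    simp only [hh']; linarith [abs_nonneg (a x), abs_nonneg (b₂ x)]
  have hbH₂ : ∀ x, |b₂ x| ≤ h' x := fun x => by
    simp only [hh']; linarith [abs_nonneg (a x), abs_nonneg (b₁ x)]
  have hf₀j := measurable_uncurry_reaction hf₀c hf₀m
  set g := truncatedReaction f₀ a b₁ b₂ with hg
  have hgdom : IsDominatedReaction s p Ω g H := by
    refine ⟨fun x => ?_, fun t => ?_, fun x t => ?_, hHv⟩
    · exact ((hf₀c x).comp (by fun_prop)).min ((hf₀c x).comp (by fun_prop))
    · exact (hf₀j.comp (measurable_id.prodMk ((measurable_const.max hmeasa).min hmeas₁))).min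
        (hf₀j.comp (measurable_id.prodMk ((measurable_const.max hmeasa).min hmeas₂)))
    · simp only [hg, truncatedReaction]
      rcases min_choice (f₀ x (min (max t (a x)) (b₁ x))) (f₀ x (min (max t (a x)) (b₂ x)))
        with h | h <;> rw [h]
      · exact hbound _ _ (abs_min_max_le (haH x) (hbH₁ x) t)
      · exact hbound _ _ (abs_min_max_le (haH x) (hbH₂ x) t)
  have hk : ∀ b : RN N → ℝ, Measurable b → (∀ x, |b x| ≤ h' x) → ∀ v, MemW0 s p Ω v →
      IntegrableOn (fun x => f₀ x (b x) * v x) Ω := by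
    intro b hbm hbh v hv
    refine (hHv v hv).mono' ((hf₀j.comp (measurable_id.prodMk hbm)).aestronglyMeasurable.mul
      hv.aestronglyMeasurable).restrict (Filter.Eventually.of_forall fun x => ?_)
    rw [Real.norm_eq_abs, abs_mul]
    exact mul_le_mul_of_nonneg_right (hbound _ _ (hbh x)) (abs_nonneg _)
  have hcongr : ∀ b u : RN N → ℝ, (∀ᵐ x ∂(volume.restrict Ω), u x = b x) → ∀ v : RN N → ℝ,
      ∫ x in Ω, f₀ x (b x) * v x = ∫ x in Ω, f x (u x) * v x := by
    intro b u hub v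
    refine integral_congr_ae ?_
    filter_upwards [hub, hf₀f] with x h1 h2
    rw [h2, h1]
  have hle : ∀ᵐ x ∂(volume.restrict Ω), a x ≤ b₁ x ∧ a x ≤ b₂ x := by
    filter_upwards [hea, he₁, he₂, hle₁, hle₂] with x h1 h2 h3 h4 h5
    rw [← h1, ← h2, ← h3]
    exact ⟨h4, h5⟩
  have hnn : ∀ u, MemW0 s p Ω u → ∀ᵐ x ∂(volume.restrict Ωᶜ), 0 ≤ u x := fun u hu => by
    filter_upwards [hu.2] with x hx using hx.ge
  have htrunc₁ : ∀ v, MemW0 s p Ω v → functional s p Ω g (fun x => min (v x) (u₁ x)) ≤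
      functional s p Ω g v := fun v hv => by
    refine hgdom.functional_min_le hp hs hΩ hb hv hW₁ (hnn _ hu₁.1) (hk b₁ hmeas₁ hbH₁)
      (fun v hv _ => by rw [hcongr b₁ u₁ he₁, hu₁.2 v hv]) ?_
    filter_upwards [he₁, hle] with x h1 h2 t ht
    rw [h1] at ht
    refine (min_le_left _ _).trans_eq ?_
    rw [max_eq_left (h2.1.trans ht), min_eq_right ht]
  have htrunc₂ : ∀ v, MemW0 s p Ω v → functional s p Ω g (fun x => min (v x) (u₂ x)) ≤
      functional s p Ω g v := fun v hv => by
    refine hgdom.functional_min_le hp hs hΩ hb hv hW₂ (hnn _ hu₂.1) (hk b₂ hmeas₂ hbH₂)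
      (fun v hv _ => by rw [hcongr b₂ u₂ he₂, hu₂.2 v hv]) ?_
    filter_upwards [he₂, hle] with x h1 h2 t ht
    rw [h1] at ht
    refine (min_le_right _ _).trans_eq ?_
    rw [max_eq_left (h2.2.trans ht), min_eq_right ht]
  have htrunc₀ : ∀ v, MemW0 s p Ω v → functional s p Ω g (fun x => max (v x) (uSub x)) ≤
      functional s p Ω g v := fun v hv => by
    refine hgdom.functional_max_le hp hs hΩ hb hv hsub.1 hsub.2.1 (hk a hmeasa haH)
      (fun v hv hv0 => by rw [hcongr a uSub hea]; exact hsub.2.2 v hv hv0) ?_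
    filter_upwards [hea, hle] with x h1 h2 t ht
    rw [h1] at ht
    simp only [hg, truncatedReaction]
    rw [max_eq_right ht, min_eq_left h2.1, min_eq_left h2.2, min_self]
  set K := orderInterval s p Ω uSub (fun x => min (u₁ x) (u₂ x)) with hK
  have hne : K.Nonempty := by
    refine ⟨fun x => min (u₁ x) (u₂ x), hu₁.1.inf hp hs hΩ hb hW₂ (hnn _ hu₂.1), ?_⟩
    filter_upwards [hle₁, hle₂] with x h1 h2
    exact ⟨le_min h1 h2, le_rfl⟩
  have hKbd : ∀ u ∈ K, ∀ᵐ x ∂(volume.restrict Ω), |u x| ≤ |h' x| := by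
    intro u hu
    filter_upwards [hu.2, hea, he₁] with x h1 h2 h3
    have h4 : u x ≤ b₁ x := (h1.2.trans (min_le_left _ _)).trans_eq h3
    have h5 : a x ≤ u x := h2.symm.trans_le h1.1
    rw [abs_of_nonneg (hh'0 x), abs_le]
    exact ⟨(abs_le.1 (haH x)).1.trans h5, h4.trans (abs_le.1 (hbH₁ x)).2⟩
  obtain ⟨u, huK, hmin⟩ := hgdom.exists_minimizer hN hp hs hΩ hb hne hhLp hHh hKbd
  -- truncating at `uSub`, `u₁` and `u₂` in turn brings any competitor into the order interval
  have hglob : ∀ v, MemW0 s p Ω v → functional s p Ω g u ≤ functional s p Ω g v := by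
    intro v hv
    have k1 := hv.sup hp hs hΩ hb hsub.1 hsub.2.1
    have k2 := k1.inf hp hs hΩ hb hW₁ (hnn _ hu₁.1)
    have k3 := k2.inf hp hs hΩ hb hW₂ (hnn _ hu₂.1)
    refine (hmin _ ⟨k3, ?_⟩).trans
      ((htrunc₂ _ k2).trans ((htrunc₁ _ k1).trans (htrunc₀ v hv)))
    filter_upwards [hle₁, hle₂] with x h1 h2
    refine ⟨le_min (le_min (le_max_right _ _) h1) h2, ?_⟩
    exact min_le_min_right _ (min_le_right _ _)
  refine ⟨u, ⟨huK.1, fun v hv => ?_⟩, huK.2.mono fun x hx => hx.1, ?_, ?_⟩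
  · rw [hgdom.pairing_eq_of_minimizer hp huK.1 hglob hv]
    refine integral_congr_ae ?_
    filter_upwards [huK.2, hea, he₁, he₂, hf₀f] with x h1 h2 h3 h4 h5
    have h6 : a x ≤ u x := h2.symm.trans_le h1.1
    have h7 : u x ≤ b₁ x := (h1.2.trans (min_le_left _ _)).trans_eq h3
    have h8 : u x ≤ b₂ x := (h1.2.trans (min_le_right _ _)).trans_eq h4
    simp only [hg, truncatedReaction]
    rw [max_eq_left h6, min_eq_left h7, min_eq_left h8, min_self, h5]
  all_goals
    have hI := (ae_restrict_iff' hΩ.measurableSet).1 huK.2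
  · filter_upwards [hI, huK.1.ae_eq_zero hΩ, hu₁.1.ae_eq_zero hΩ] with x h1 h2 h3
    by_cases hx : x ∈ Ω
    · exact (h1 hx).2.trans (min_le_left _ _)
    · rw [h2 hx, h3 hx]
  · filter_upwards [hI, huK.1.ae_eq_zero hΩ, hu₂.1.ae_eq_zero hΩ] with x h1 h2 h3
    by_cases hx : x ∈ Ω
    · exact (h1 hx).2.trans (min_le_right _ _)
    · rw [h2 hx, h3 hx]

/-! ### Reflection -/

theorem H0.reflect {f : RN N → ℝ → ℝ} (hf : H0 s p Ω f) : H0 s p Ω (fun x t => -f x (-t)) := by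
  obtain ⟨⟨h1, h2⟩, c₀, q, hc₀, hpq, hq, h3⟩ := hf
  refine ⟨⟨fun t => (h1 (-t)).neg, ?_⟩, c₀, q, hc₀, hpq, hq, ?_⟩
  · filter_upwards [h2] with x hx
    exact (hx.comp continuous_neg).neg
  · filter_upwards [h3] with x hx t
    simpa using hx (-t)

theorem IsSolution.reflect {f : RN N → ℝ → ℝ} (hp : 0 < p) (hu : IsSolution s p Ω f u) :
    IsSolution s p Ω (fun x t => -f x (-t)) (fun x => -u x) := by
  refine ⟨hu.1.neg hp, fun v hv => ?_⟩
  rw [pairing_neg_left, hu.2 v hv, ← integral_neg]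
  simp

theorem IsSupersolution.reflect {f : RN N → ℝ → ℝ} (hu : IsSupersolution s p Ω f u) :
    IsSubsolution s p Ω (fun x t => -f x (-t)) (fun x => -u x) := by
  refine ⟨hu.1.neg, ?_, fun v hv hv0 => ?_⟩
  · filter_upwards [hu.2.1] with x hx using by linarith
  · have := hu.2.2 v hv hv0
    rw [pairing_neg_left]
    simp only [neg_neg, neg_mul, integral_neg]
    linarith

end FracPLaplace

theorem lemma3p3 (N : ℕ) (hN : 1 < N) (p s : ℝ) (hp : 2 ≤ p) (hs0 : 0 < s) (hs1 : s < 1)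
    (hNps : p * s < (N : ℝ)) (Ω : Set (FracPLaplace.RN N)) (hΩ : FracPLaplace.IsC11Domain Ω)
    (f : FracPLaplace.RN N → ℝ → ℝ) (hf : FracPLaplace.H0 s p Ω f)
    (uSub uSup : FracPLaplace.RN N → ℝ)
    (hpair : FracPLaplace.IsSubSuperPair s p Ω f uSub uSup) :
    FracPLaplace.DownwardDirected (FracPLaplace.solutionSet s p Ω f uSub uSup) ∧
      FracPLaplace.UpwardDirected (FracPLaplace.solutionSet s p Ω f uSub uSup) := by
  have hN0 : 0 < N := by omega
  have hp0 : 0 < p := by linarith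
  constructor
  · rintro u₁ ⟨hu₁, ha₁, hb₁⟩ u₂ ⟨hu₂, ha₂, -⟩
    obtain ⟨u, hu, hsub, h1, h2⟩ := FracPLaplace.exists_solution_le hN0 hp hs0 hNps hΩ.isOpen
      hΩ.isBounded hf hpair.sub hu₁ hu₂ ha₁ ha₂
    exact ⟨u, ⟨hu, hsub, Filter.EventuallyLE.trans (ae_restrict_of_ae h1) hb₁⟩, h1, h2⟩
  · rintro u₁ ⟨hu₁, ha₁, hb₁⟩ u₂ ⟨hu₂, -, hb₂⟩
    obtain ⟨u, hu, hsub, h1, h2⟩ := FracPLaplace.exists_solution_le hN0 hp hs0 hNps hΩ.isOpen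
      hΩ.isBounded hf.reflect hpair.super.reflect (hu₁.reflect hp0) (hu₂.reflect hp0)
      (hb₁.mono fun x hx => neg_le_neg hx) (hb₂.mono fun x hx => neg_le_neg hx)
    have h1' : u₁ ≤ᵐ[volume] fun x => -u x := h1.mono fun x hx => le_neg_of_le_neg hx
    have h2' : u₂ ≤ᵐ[volume] fun x => -u x := h2.mono fun x hx => le_neg_of_le_neg hx
    have hu' := hu.reflect hp0
    simp only [neg_neg] at hu'
    exact ⟨fun x => -u x, ⟨hu', ha₁.trans (ae_restrict_of_ae h1'),
      hsub.mono fun x hx => neg_le.1 hx⟩, h1', h2'⟩
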